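/- There are families $\mathcal S_d$ ($d=1,2,\dots$) of Borel subsets of $\mathbb R^d$ and a constant $C>0$ such that for every $d\ge 1$ the Gaussian surface area satisfies $\Gamma(\mathcal S_d)\le C\,d$ and the VC dimension of $\mathcal S_d$ is exactly $2^d$, and for which estimating a truncated mean needs $\Omega(2^{d/2})$ samples, in the following sense. There is an absolute constant $\alpha>0$ such that for every $p>1/2$ there is a constant $c>0$ (depending only on $p$) with the following property. Let $d\ge 1$, let $m\ge 0$, and let $A$ be a (possibly randomized) algorithm that maps $m$ points of $\mathbb R^d$ to an estimate in $\mathbb R^d$. Suppose that for every $S\in\mathcal S_d$ and every $\mu\in\mathbb R^d$ with $\mathcal N(\mu,I;S)\ge\alpha$, the output $\tilde\mu$ of $A$ on $m$ independent samples from $\mathcal N(\mu,I,S)$ satisfies $\|\tilde\mu-\mu\|_2\le 1$ with probability at least $p$ (the algorithm sees only the samples, not $S$ or $\mu$). Then $m\ge c\,2^{d/2}$. Here $\mathcal N(\mu,I;S)$ is the mass that the normal distribution $\mathcal N(\mu,I)$ gives to $S$, and $\mathcal N(\mu,I,S)$ is $\mathcal N(\mu,I)$ conditioned on $S$. The Gaussian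 surface area of a Borel set $B\subseteq\mathbb R^d$ is $\Gamma(B)=\liminf_{\delta\to0^+}\mathcal N(0,I;B_\delta\setminus B)/\delta$ with $B_\delta=\{x:\operatorname{dist}(x,B)\le\delta\}$, and $\Gamma(\mathcal S)=\sup_{S\in\mathcal S}\Gamma(S)$. The VC dimension of $\mathcal S$ is the supremum of $|X|$ over the finite sets $X$ all of whose subsets have the form $X\cap S$ with $S\in\mathcal S$. -/

import Mathlib

open MeasureTheory ProbabilityTheory Filter Topology
open scoped ENNReal NNReal

noncomputable section

/-- The normal distribution `N(μ, I)` on `ℝ^d`, with mean `μ` and identity covariance matrix. -/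
def normalId (d : ℕ) (μ : EuclideanSpace ℝ (Fin d)) : Measure (EuclideanSpace ℝ (Fin d)) :=
  multivariateGaussian μ (1 : Matrix (Fin d) (Fin d) ℝ)

/-- The truncated normal distribution `N(μ, I, S)`: the normal distribution `N(μ, I)` conditioned
on taking values in `S`. -/
def truncatedNormalId (d : ℕ) (μ : EuclideanSpace ℝ (Fin d)) (S : Set (EuclideanSpace ℝ (Fin d))) :
    Measure (EuclideanSpace ℝ (Fin d)) :=
  (normalId d μ)[|S]

/-- The Gaussian surface area `Γ(A) = liminf_{δ → 0+} N₀(A_δ \ A) / δ`, where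
`A_δ = {x : dist(x, A) ≤ δ}` and `N₀ = N(0, I)`. -/
def gaussianSurfaceArea (d : ℕ) (A : Set (EuclideanSpace ℝ (Fin d))) : ℝ≥0∞ :=
  liminf (fun δ : ℝ => normalId d 0 (Metric.cthickening δ A \ A) / ENNReal.ofReal δ) (𝓝[>] 0)

/-- The Gaussian surface area of a family of sets: the supremum over its members. -/
def familyGaussianSurfaceArea (d : ℕ) (𝒮 : Set (Set (EuclideanSpace ℝ (Fin d)))) : ℝ≥0∞ :=
  ⨆ S ∈ 𝒮, gaussianSurfaceArea d S

/-- The family `𝒮` shatters the finite set `X`: every subset of `X` is cut out by a member. -/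
def FamilyShatters {E : Type*} (𝒮 : Set (Set E)) (X : Finset E) : Prop :=
  ∀ Y : Finset E, Y ⊆ X → ∃ S ∈ 𝒮, (X : Set E) ∩ S = (Y : Set E)

/-- The VC dimension of a family of sets: the supremum of the cardinalities of the finite sets
that it shatters. -/
def familyVCDim {E : Type*} (𝒮 : Set (Set E)) : ℕ∞ :=
  ⨆ (X : Finset E) (_ : FamilyShatters 𝒮 X), (X.card : ℕ∞)

/-- The algorithm `A` (possibly randomized: a Markov kernel from `m`-tuples of samples to the
estimate) estimates the mean to within distance `1` with probability at least `p`: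
for every (unknown) `S ∈ 𝒮` and every (unknown) `μ` such that `N(μ, I)` puts mass at least `α`
on `S`, if it is run on `m` independent samples from `N(μ, I, S)`, then its output is within
distance `1` of `μ` with probability at least `p`. The algorithm is given only the samples; it may
depend on `d`, `𝒮`, `α`, `p`, `m`, but not on `S` or `μ`. -/
def EstimatesMean (d : ℕ) (𝒮 : Set (Set (EuclideanSpace ℝ (Fin d)))) (α p : ℝ) (m : ℕ)
    (A : Kernel (Fin m → EuclideanSpace ℝ (Fin d)) (EuclideanSpace ℝ (Fin d))) : Prop :=
  ∀ S ∈ 𝒮, ∀ μ : EuclideanSpace ℝ (Fin d), α ≤ (normalId d μ).real S →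
    p ≤ ((Measure.pi fun _ : Fin m => truncatedNormalId d μ S).bind A).real {x | ‖x - μ‖ ≤ 1}

end

/-!
For `d = n + 3` the hard family is built from three special coordinates and the `2 ^ n` cells given
by the signs of the others. The coordinate `x 0` is mapped to a uniform point of the circle `ℝ / ℤ`
by the distribution function of `N(0, 1)`. In each cell `j`, a set of the family consists of the points
for which this uniform point, rotated by a parameter `θ j`, falls into an arc whose length
`q (x 1) = sigmoid (-4 * x 1)` depends on `x 1`; the family also contains the complements.

Let `φ₁`, `φ₂` be the densities of `N(2 e₁, I)` and `N(-2 e₁, I)`. Since `φ₁ / φ₂ = exp (4 * x 1)`,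
`q = φ₂ / (φ₁ + φ₂)` and `1 - q = φ₁ / (φ₁ + φ₂)`, so that `q φ₁ = (1 - q) φ₂`. If the parameters
`θ j` are independent and uniform, the random set covers each point with probability `q`, and its
complement with probability `1 - q`. Moreover the mass of the set under `N(2 e₁, I)`, and of its
complement under `N(-2 e₁, I)`, is the same constant `bandMass` for all `θ` and all dimensions,
because `x 0` is independent of everything else. Hence, as long as all the samples fall into
different cells, the samples from `N(2 e₁, I)` truncated to the random set and from `N(-2 e₁, I)`
truncated to its complement have the same law (`lintegral_cellwiseSet`). By the birthday bound
(`pi_compl_distinctCells_le`) a collision has probability at most `m² / 2 ^ n`, while the unit balls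
around the two means are disjoint; this gives `two_mul_le_of_estimator`.

The boundary of such a set is contained in the coordinate hyperplanes and in the set where the
rotated uniform point is an end point of the arc; as all functions involved are 1-Lipschitz, the
Gaussian mass of its `δ`-neighbourhood is `O(d δ)`. In a single cell the family has one real
parameter, which a point compares with at most three thresholds, so no nine points of a cell are
shattered (`card_le_of_thresholds`); therefore the VC dimension is at most `8 * 2 ^ n = 2 ^ d`. It
becomes exactly `2 ^ d` on adding suitable unions of orthants, since adding one set raises the
VC dimension by at most one (`exists_familyVCDim_union_eq`). The spare third coordinate only serves
to make the crude bound `8` sufficient.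
-/

/-! ### VC dimension -/

section VC
variable {E : Type*}

lemma familyVCDim_le_iff {𝒮 : Set (Set E)} {N : ℕ} :
    familyVCDim 𝒮 ≤ N ↔ ∀ X : Finset E, FamilyShatters 𝒮 X → X.card ≤ N := by
  simp only [familyVCDim, iSup_le_iff, Nat.cast_le]

lemma FamilyShatters.card_le_familyVCDim {𝒮 : Set (Set E)} {X : Finset E}
    (h : FamilyShatters 𝒮 X) : (X.card : ℕ∞) ≤ familyVCDim 𝒮 :=
  le_iSup₂_of_le X h le_rfl

lemma FamilyShatters.mono {𝒮 𝒯 : Set (Set E)} {X : Finset E} (h : FamilyShatters 𝒮 X)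
    (hST : 𝒮 ⊆ 𝒯) : FamilyShatters 𝒯 X := fun Y hY ↦
  let ⟨S, hS, e⟩ := h Y hY
  ⟨S, hST hS, e⟩

/-- Two extensions of a subset of `X \ {a}` to `X` are cut out by different members, so one of
them avoids the added set. -/
lemma FamilyShatters.erase_of_insert [DecidableEq E] {𝒮 : Set (Set E)} {S₀ : Set E} {X : Finset E}
    (h : FamilyShatters (insert S₀ 𝒮) X) {a : E} (ha : a ∈ X) :
    FamilyShatters 𝒮 (X.erase a) := by
  intro Y hY
  have hYX : Y ⊆ X := hY.trans (X.erase_subset a)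
  have haY : a ∉ Y := fun h' ↦ Finset.notMem_erase a X (hY h')
  obtain ⟨S₁, hS₁, e₁⟩ := h Y hYX
  obtain ⟨S₂, hS₂, e₂⟩ := h (insert a Y) (Finset.insert_subset ha hYX)
  have m₁ : ∀ x, x ∈ X ∧ x ∈ S₁ ↔ x ∈ Y := fun x ↦ by simpa using Set.ext_iff.1 e₁ x
  have m₂ : ∀ x, x ∈ X ∧ x ∈ S₂ ↔ x = a ∨ x ∈ Y := fun x ↦ by simpa using Set.ext_iff.1 e₂ x
  have h₁ : S₁ ∈ 𝒮 ∨ S₂ ∈ 𝒮 := by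
    rcases hS₁ with rfl | hS₁
    · rcases hS₂ with rfl | hS₂
      · exact absurd ((m₁ a).1 ((m₂ a).2 (Or.inl rfl))) haY
      · exact Or.inr hS₂
    · exact Or.inl hS₁
  rcases h₁ with h₁ | h₁
  · refine ⟨S₁, h₁, Set.ext fun x ↦ ?_⟩
    have := m₁ x
    simp only [Set.mem_inter_iff, Finset.mem_coe, Finset.mem_erase]
    grind
  · refine ⟨S₂, h₁, Set.ext fun x ↦ ?_⟩
    have := m₂ x
    simp only [Set.mem_inter_iff, Finset.mem_coe, Finset.mem_erase]
    grind

lemma familyVCDim_insert_le {𝒮 : Set (Set E)} {S₀ : Set E} {N : ℕ}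
    (h : familyVCDim 𝒮 ≤ N) : familyVCDim (insert S₀ 𝒮) ≤ (N + 1 : ℕ) := by
  classical
  rw [familyVCDim_le_iff] at h ⊢
  intro X hX
  rcases X.eq_empty_or_nonempty with rfl | ⟨a, ha⟩
  · simp
  · have := h _ (hX.erase_of_insert ha)
    rw [Finset.card_erase_of_mem ha] at this
    omega

/-- Discrete continuity of the VC dimension: as the members of a finite family are added one by
one, the VC dimension takes all intermediate values. -/
lemma exists_familyVCDim_union_eq {𝒮 ℱ : Set (Set E)} (hℱ : ℱ.Finite) {N : ℕ}
    (h₁ : familyVCDim 𝒮 ≤ N) (h₂ : (N : ℕ∞) ≤ familyVCDim (𝒮 ∪ ℱ)) :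
    ∃ ℱ' ⊆ ℱ, familyVCDim (𝒮 ∪ ℱ') = N := by
  induction ℱ, hℱ using Set.Finite.induction_on with
  | empty => exact ⟨∅, subset_rfl, le_antisymm (by simpa using h₁) h₂⟩
  | @insert S₀ ℱ₀ _ _ ih =>
    by_cases h : (N : ℕ∞) ≤ familyVCDim (𝒮 ∪ ℱ₀)
    · obtain ⟨ℱ', hs, e⟩ := ih h
      exact ⟨ℱ', hs.trans (Set.subset_insert _ _), e⟩
    · refine ⟨insert S₀ ℱ₀, subset_rfl, le_antisymm ?_ h₂⟩
      push Not at h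
      cases N with
      | zero => simp at h
      | succ k =>
        rw [Set.union_insert]
        refine familyVCDim_insert_le (Order.le_of_lt_add_one ?_)
        exact_mod_cast h

/-- If the space is partitioned into finitely many cells, and no shattered subset of a cell has
more than `N` points, then the VC dimension is at most `N` times the number of cells. -/
lemma familyVCDim_le_of_cells {ι : Type*} [Fintype ι] {𝒮 : Set (Set E)} (cell : E → ι) {N : ℕ}
    (h : ∀ (j : ι) (X : Finset E), (∀ x ∈ X, cell x = j) → FamilyShatters 𝒮 X → X.card ≤ N) :
    familyVCDim 𝒮 ≤ (N * Fintype.card ι : ℕ) := by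
  classical
  rw [familyVCDim_le_iff]
  intro X hX
  refine Finset.card_le_mul_card_image_of_maps_to (f := cell) (t := Finset.univ)
    (fun _ _ ↦ Finset.mem_univ _) N fun j _ ↦ h j _ (by simp) fun Y hY ↦ ?_
  obtain ⟨S, hS, e⟩ := hX Y (hY.trans (Finset.filter_subset _ _))
  refine ⟨S, hS, Set.ext fun x ↦ ?_⟩
  have h₁ := Set.ext_iff.1 e x
  have h₂ := @hY x
  simp only [Set.mem_inter_iff, Finset.mem_coe, Finset.mem_filter] at *
  grind

/-- A one-parameter family of subsets of a finite set `X`, for which the membership of each point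
changes only when the parameter crosses one of at most three thresholds, has at most
`3 |X| + 1` members; together with their complements these are at most `6 |X| + 2` sets, which is
too few to shatter nine points. -/
lemma card_le_of_thresholds (T : ℝ → Set E) (C : E → Finset ℝ) (hC : ∀ x, (C x).card ≤ 3)
    (hT : ∀ x θ θ', (∀ c ∈ C x, c ≤ θ ↔ c ≤ θ') → (x ∈ T θ ↔ x ∈ T θ'))
    (X : Finset E) (hX : ∀ Y ⊆ X, ∃ θ, (X : Set E) ∩ T θ = Y ∨ (X : Set E) ∩ (T θ)ᶜ = Y) :
    X.card ≤ 8 := by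
  classical
  -- a set `Y` cut out by `T θ` or its complement is determined by the number of thresholds below
  -- `θ` and by the choice between the two
  choose! θ hθ using hX
  set D := X.biUnion C with hD
  have hDcard : D.card ≤ X.card * 3 := Finset.card_biUnion_le_card_mul _ _ _ fun x _ ↦ hC x
  let r : ℝ → ℕ := fun t ↦ (D.filter (· ≤ t)).card
  have hr : ∀ s t, s ≤ t → r s = r t → ∀ c ∈ D, c ≤ s ↔ c ≤ t := by
    intro s t hst e c hc
    have hsub : D.filter (· ≤ s) ⊆ D.filter (· ≤ t) :=
      Finset.monotone_filter_right _ fun c _ h ↦ h.trans hst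
    have := Finset.ext_iff.1 (Finset.eq_of_subset_of_card_le hsub e.ge) c
    simpa [hc] using this
  have hr' : ∀ s t, r s = r t → ∀ x ∈ X, x ∈ T s ↔ x ∈ T t := by
    intro s t e x hx
    refine hT x s t fun c hc ↦ ?_
    have hcD : c ∈ D := Finset.mem_biUnion.2 ⟨x, hx, hc⟩
    rcases le_total s t with h | h
    · exact hr s t h e c hcD
    · exact (hr t s h e.symm c hcD).symm
  let f : Finset E → ℕ × Bool := fun Y ↦ (r (θ Y), decide ((X : Set E) ∩ T (θ Y) = Y))
  have hcard : X.powerset.card ≤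
      (Finset.range (X.card * 3 + 1) ×ˢ (Finset.univ : Finset Bool)).card := by
    refine Finset.card_le_card_of_injOn f ?_ ?_
    · intro Y _
      simp only [f, r, Finset.coe_product, Finset.coe_univ, Set.mem_prod, Set.mem_univ, and_true,
        Finset.coe_range, Set.mem_Iio]
      exact Nat.lt_succ_of_le ((Finset.card_filter_le _ _).trans hDcard)
    · intro Y hY Y' hY' e
      have hY := hθ Y (by simpa using hY)
      have hY' := hθ Y' (by simpa using hY')
      simp only [f, Prod.mk.injEq, decide_eq_decide] at e
      have key := hr' _ _ e.1
      have e1 : (X : Set E) ∩ T (θ Y) = (X : Set E) ∩ T (θ Y') := by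
        ext x; have := key x; simp only [Set.mem_inter_iff, Finset.mem_coe]; grind
      have e2 : (X : Set E) ∩ (T (θ Y))ᶜ = (X : Set E) ∩ (T (θ Y'))ᶜ := by
        ext x; have := key x
        simp only [Set.mem_inter_iff, Finset.mem_coe, Set.mem_compl_iff]; grind
      apply Finset.coe_injective
      by_cases h : (X : Set E) ∩ T (θ Y) = Y
      · rw [← h, ← e.2.1 h, e1]
      · rw [← hY.resolve_left h, ← hY'.resolve_left fun h' ↦ h (e.2.2 h'), e2]
  rw [Finset.card_powerset, Finset.card_product, Finset.card_range, Finset.card_univ,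
    Fintype.card_bool] at hcard
  by_contra! h
  have : ∀ n, 9 ≤ n → (n * 3 + 1) * 2 < 2 ^ n := by
    intro n hn
    induction n, hn using Nat.le_induction with
    | base => norm_num
    | succ k hk ih => rw [pow_succ]; omega
  exact absurd hcard (not_le.2 (this _ h))

end VC

/-! ### Product measures -/

section ProductMeasures

lemma lintegral_pi_prod {n : ℕ} {E : Fin n → Type*} [∀ i, MeasurableSpace (E i)]
    {μ : ∀ i, Measure (E i)} [∀ i, SigmaFinite (μ i)] {f : ∀ i, E i → ℝ≥0∞}
    (hf : ∀ i, Measurable (f i)) :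
    ∫⁻ x, ∏ i, f i (x i) ∂Measure.pi μ = ∏ i, ∫⁻ t, f i t ∂μ i := by
  induction n with
  | zero => simp
  | succ n ih =>
    have hm : Measurable fun x : ∀ i : Fin n, E i.succ ↦ ∏ i, f i.succ (x i) :=
      Finset.measurable_prod _ fun i _ ↦ (hf i.succ).comp (measurable_pi_apply i)
    rw [← (measurePreserving_piFinSuccAbove μ 0).symm.lintegral_comp_emb
      (MeasurableEquiv.measurableEmbedding _), Fin.prod_univ_succ,
      ← ih (fun i ↦ hf i.succ), ← lintegral_prod_mul (hf 0).aemeasurable hm.aemeasurable]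
    simp_rw [MeasurableEquiv.piFinSuccAbove_symm_apply, Fin.insertNthEquiv,
      Fin.prod_univ_succ, Fin.insertNth_zero]
    rfl

lemma pi_withDensity {n : ℕ} {E : Fin n → Type*} [∀ i, MeasurableSpace (E i)]
    {μ : ∀ i, Measure (E i)} [∀ i, SigmaFinite (μ i)] {f : ∀ i, E i → ℝ≥0∞}
    (hf : ∀ i, Measurable (f i)) [∀ i, SigmaFinite ((μ i).withDensity (f i))] :
    Measure.pi (fun i ↦ (μ i).withDensity (f i))
      = (Measure.pi μ).withDensity fun x ↦ ∏ i, f i (x i) := by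
  refine Measure.pi_eq fun s hs ↦ ?_
  rw [withDensity_apply _ (MeasurableSet.univ_pi hs), Measure.restrict_pi_pi,
    lintegral_pi_prod hf]
  exact Finset.prod_congr rfl fun i _ ↦ (withDensity_apply _ (hs i)).symm

/-- Resampling one coordinate of a product measure does not change it. -/
lemma measurePreserving_update {ι : Type*} [Fintype ι] [DecidableEq ι] {E : ι → Type*}
    [∀ i, MeasurableSpace (E i)] (μ : ∀ i, Measure (E i)) [∀ i, IsProbabilityMeasure (μ i)]
    (i : ι) :
    MeasurePreserving (fun p : (∀ i, E i) × E i ↦ Function.update p.1 i p.2)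
      ((Measure.pi μ).prod (μ i)) (Measure.pi μ) := by
  have hm : Measurable fun p : (∀ i, E i) × E i ↦ Function.update p.1 i p.2 := by
    refine measurable_pi_lambda _ fun j ↦ ?_
    by_cases h : j = i
    · subst h; simpa using measurable_snd
    · simp only [Function.update_of_ne h]
      exact (measurable_pi_apply j).comp measurable_fst
  refine ⟨hm, (Measure.pi_eq fun s hs ↦ ?_).symm⟩
  rw [Measure.map_apply hm (MeasurableSet.univ_pi hs)]
  have : (fun p : (∀ i, E i) × E i ↦ Function.update p.1 i p.2) ⁻¹' Set.univ.pi s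
      = (Set.univ.pi (Function.update s i Set.univ)) ×ˢ s i := by
    ext ⟨x, t⟩
    simp only [Set.mem_preimage, Set.mem_univ_pi, Set.mem_prod]
    constructor
    · intro h
      refine ⟨fun j ↦ ?_, by simpa using h i⟩
      by_cases hj : j = i
      · subst hj; simp
      · simpa [hj] using h j
    · rintro ⟨h, ht⟩ j
      by_cases hj : j = i
      · subst hj; simpa using ht
      · simpa [hj] using h j
  rw [this, Measure.prod_prod, Measure.pi_pi, ← Finset.mul_prod_erase _ _ (Finset.mem_univ i),
    ← Finset.mul_prod_erase _ (fun i ↦ μ i (s i)) (Finset.mem_univ i)]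
  rw [Function.update_self, measure_univ, one_mul, mul_comm]
  congr 1
  refine Finset.prod_congr rfl fun j hj ↦ ?_
  rw [Function.update_of_ne (Finset.ne_of_mem_erase hj)]

end ProductMeasures

/-! ### The two-point bound for random sets assembled from cells -/

section Mixture

variable {E T ι : Type*}

/-- The set assembled from the slices of `K`: in the cell `j`, a point `x` belongs to it if
`(x, θ j) ∈ K`, where `θ j` is the parameter of that cell. -/
def cellwiseSet (cell : E → ι) (K : Set (E × T)) (θ : ι → T) : Set E :=
  {x | (x, θ (cell x)) ∈ K}

/-- The `m`-tuples of points that lie in pairwise different cells. -/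
def distinctCells (cell : E → ι) (m : ℕ) : Set (Fin m → E) :=
  {x | Function.Injective fun l ↦ cell (x l)}

variable [Fintype ι]

/-- Points in different cells see independent parameters. -/
lemma pi_setOf_forall_mem [MeasurableSpace T] {cell : E → ι} (τ : Measure T)
    [IsProbabilityMeasure τ] (K : Set (E × T)) {m : ℕ} {x : Fin m → E}
    (hx : x ∈ distinctCells cell m) :
    Measure.pi (fun _ : ι ↦ τ) {θ | ∀ l, (x l, θ (cell (x l))) ∈ K}
      = ∏ l, τ {t | (x l, t) ∈ K} := by
  have hset : {θ : ι → T | ∀ l, (x l, θ (cell (x l))) ∈ K}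
      = Set.univ.pi fun j ↦ {t | ∀ l, cell (x l) = j → (x l, t) ∈ K} := by
    ext θ
    simp only [Set.mem_ofPred_eq, Set.mem_univ_pi]
    exact ⟨fun h j l e ↦ e ▸ h l, fun h l ↦ h _ l rfl⟩
  rw [hset, Measure.pi_pi]
  symm
  refine Finset.prod_of_injOn (fun l ↦ cell (x l)) hx.injOn
    (fun _ _ ↦ Finset.mem_coe.2 (Finset.mem_univ _)) ?_ ?_
  · intro j _ hj
    have : {t : T | ∀ l, cell (x l) = j → (x l, t) ∈ K} = Set.univ := by
      ext t
      simp only [Set.mem_ofPred_eq, Set.mem_univ, iff_true]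
      exact fun l e ↦ absurd ⟨l, Finset.mem_coe.2 (Finset.mem_univ _), e⟩ hj
    rw [this, measure_univ]
  · intro l _
    congr 1
    ext t
    simp only [Set.mem_ofPred_eq]
    refine ⟨fun h l' e ↦ ?_, fun h ↦ h l rfl⟩
    rw [hx e]
    exact h

/-- The birthday bound: if each of the cells has probability `1 / |ι|`, then `m` independent
samples collide in some cell with probability at most `m² / |ι|`. -/
lemma pi_compl_distinctCells_le [MeasurableSpace E] {cell : E → ι} (ν : Measure E)
    [IsProbabilityMeasure ν] (hν : ∀ j, ν (cell ⁻¹' {j}) = (Fintype.card ι : ℝ≥0∞)⁻¹) (m : ℕ) :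
    Measure.pi (fun _ : Fin m ↦ ν) (distinctCells cell m)ᶜ
      ≤ (m : ℝ≥0∞) ^ 2 * (Fintype.card ι : ℝ≥0∞)⁻¹ := by
  classical
  set κ := (Fintype.card ι : ℝ≥0∞)⁻¹ with hκ
  have hpair : ∀ k l : Fin m, k ≠ l →
      Measure.pi (fun _ : Fin m ↦ ν) {x | cell (x k) = cell (x l)} ≤ κ := by
    intro k l hkl
    have hsub : {x : Fin m → E | cell (x k) = cell (x l)} ⊆
        ⋃ j : ι, Set.univ.pi fun i ↦ if i = k ∨ i = l then cell ⁻¹' {j} else Set.univ := by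
      intro x hx
      refine Set.mem_iUnion.2 ⟨cell (x k), fun i _ ↦ ?_⟩
      dsimp only
      split_ifs with h
      · rcases h with rfl | rfl
        · rfl
        · exact (Eq.symm hx : cell (x i) = cell (x k))
      · trivial
    have hj : ∀ j : ι, Measure.pi (fun _ : Fin m ↦ ν)
        (Set.univ.pi fun i ↦ if i = k ∨ i = l then cell ⁻¹' {j} else Set.univ) = κ * κ := by
      intro j
      rw [Measure.pi_pi, ← Finset.prod_subset (Finset.subset_univ ({k, l} : Finset (Fin m)))]
      · rw [Finset.prod_pair hkl]; simp [hν]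
      · intro i _ hi
        simp only [Finset.mem_insert, Finset.mem_singleton] at hi
        rw [if_neg hi, measure_univ]
    refine (measure_mono hsub).trans ((measure_iUnion_le _).trans ?_)
    simp_rw [hj]
    rw [tsum_fintype, Finset.sum_const, Finset.card_univ, nsmul_eq_mul, ← mul_assoc]
    exact mul_le_of_le_one_left' (ENNReal.mul_inv_le_one _)
  have hsub : (distinctCells cell m)ᶜ ⊆
      ⋃ p ∈ (Finset.univ : Finset (Fin m)).offDiag,
        {x : Fin m → E | cell (x p.1) = cell (x p.2)} := by
    intro x hx
    simp only [distinctCells, Set.mem_compl_iff, Set.mem_ofPred_eq, Function.Injective] at hx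
    push Not at hx
    obtain ⟨k, l, e, hkl⟩ := hx
    exact Set.mem_biUnion (x := (k, l)) (by simpa using hkl) e
  refine (measure_mono hsub).trans ((measure_biUnion_finset_le _ _).trans ?_)
  refine (Finset.sum_le_card_nsmul _ _ κ
    fun p hp ↦ hpair _ _ (Finset.mem_offDiag.1 hp).2.2).trans ?_
  rw [nsmul_eq_mul]
  gcongr
  rw [Finset.offDiag_card, Finset.card_univ, Fintype.card_fin, sq]
  exact_mod_cast Nat.sub_le _ _

variable [MeasurableSpace E] [MeasurableSpace T] [MeasurableSpace ι]
  [MeasurableSingletonClass ι]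

lemma measurable_eval_cell {cell : E → ι} (hcell : Measurable cell) :
    Measurable fun p : (ι → T) × E ↦ p.1 (cell p.2) := by
  have : Measurable fun p : (ι → T) × ι ↦ p.1 p.2 :=
    measurable_from_prod_countable_left fun j ↦ measurable_pi_apply j
  exact this.comp (measurable_fst.prodMk (hcell.comp measurable_snd))

lemma measurableSet_cellwiseSet {cell : E → ι} (hcell : Measurable cell) {K : Set (E × T)}
    (hK : MeasurableSet K) (θ : ι → T) : MeasurableSet (cellwiseSet cell K θ) :=
  (measurable_id.prodMk ((Measurable.of_discrete (f := θ)).comp hcell)) hK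

lemma measurableSet_distinctCells {cell : E → ι} (hcell : Measurable cell) (m : ℕ) :
    MeasurableSet (distinctCells cell m) := by
  have : Measurable fun (x : Fin m → E) (l : Fin m) ↦ cell (x l) :=
    measurable_pi_lambda _ fun l ↦ hcell.comp (measurable_pi_apply l)
  exact this (Set.toFinite {c : Fin m → ι | Function.Injective c}).measurableSet

/-- If the parameters of the cells are drawn independently from `τ`, then, as long as no two
samples fall into the same cell, sampling from the random set is the same as sampling from the
measure whose density is the probability that the random set covers the point. -/
lemma lintegral_cellwiseSet {cell : E → ι} (hcell : Measurable cell) (τ : Measure T)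
    [IsProbabilityMeasure τ] {K : Set (E × T)} (hK : MeasurableSet K) (N : Measure E)
    [IsFiniteMeasure N] {m : ℕ} {f : (Fin m → E) → ℝ≥0∞} (hf : Measurable f) :
    (Measurable fun θ ↦ ∫⁻ x in distinctCells cell m, f x
      ∂Measure.pi fun _ ↦ N.restrict (cellwiseSet cell K θ)) ∧
    ∫⁻ θ, ∫⁻ x in distinctCells cell m, f x
        ∂(Measure.pi fun _ ↦ N.restrict (cellwiseSet cell K θ)) ∂(Measure.pi fun _ : ι ↦ τ)
      = ∫⁻ x in distinctCells cell m, f x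
        ∂(Measure.pi fun _ ↦ N.withDensity fun x ↦ τ {t | (x, t) ∈ K}) := by
  set D := distinctCells cell m with hD
  have hDm : MeasurableSet D := measurableSet_distinctCells hcell m
  have hq : Measurable fun x ↦ τ {t | (x, t) ∈ K} := measurable_measure_prodMk_left hK
  have : IsFiniteMeasure (N.withDensity fun x ↦ τ {t | (x, t) ∈ K}) := by
    refine isFiniteMeasure_withDensity (ne_top_of_le_ne_top (measure_ne_top N Set.univ) ?_)
    calc ∫⁻ x, τ {t | (x, t) ∈ K} ∂N ≤ ∫⁻ _, 1 ∂N := lintegral_mono fun _ ↦ prob_le_one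
      _ = N Set.univ := by simp
  let J : Set ((ι → T) × (Fin m → E)) := {p | ∀ l, (p.2 l, p.1 (cell (p.2 l))) ∈ K}
  have hJ : MeasurableSet J := by
    have : J = ⋂ l, {p | (p.2 l, p.1 (cell (p.2 l))) ∈ K} := by ext; simp [J]
    rw [this]
    refine MeasurableSet.iInter fun l ↦ ?_
    have h₁ : Measurable fun p : (ι → T) × (Fin m → E) ↦ p.2 l :=
      (measurable_pi_apply l).comp measurable_snd
    exact (h₁.prodMk ((measurable_eval_cell hcell).comp (measurable_fst.prodMk h₁))) hK
  have hF : Measurable fun p : (ι → T) × (Fin m → E) ↦ J.indicator (fun p ↦ D.indicator f p.2) p :=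
    ((hf.indicator hDm).comp measurable_snd).indicator hJ
  have hinner : ∀ θ : ι → T, ∫⁻ x in D, f x ∂(Measure.pi fun _ ↦ N.restrict (cellwiseSet cell K θ))
      = ∫⁻ x, J.indicator (fun p ↦ D.indicator f p.2) (θ, x) ∂(Measure.pi fun _ : Fin m ↦ N) := by
    intro θ
    have hS : MeasurableSet (Set.univ.pi fun _ : Fin m ↦ cellwiseSet cell K θ) :=
      MeasurableSet.univ_pi fun _ ↦ measurableSet_cellwiseSet hcell hK θ
    rw [← Measure.restrict_pi_pi, ← lintegral_indicator hDm, ← lintegral_indicator hS]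
    refine lintegral_congr fun x ↦ ?_
    by_cases h : (θ, x) ∈ J
    · rw [Set.indicator_of_mem h, Set.indicator_of_mem]
      exact fun l _ ↦ h l
    · rw [Set.indicator_of_notMem h, Set.indicator_of_notMem]
      exact fun h' ↦ h fun l ↦ h' l trivial
  simp_rw [hinner]
  refine ⟨hF.lintegral_prod_right', ?_⟩
  have hprod : Measurable fun x : Fin m → E ↦ ∏ l, τ {t | (x l, t) ∈ K} :=
    Finset.measurable_prod _ fun i _ ↦ hq.comp (measurable_pi_apply i)
  rw [lintegral_lintegral_swap hF.aemeasurable, pi_withDensity fun _ ↦ hq,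
    setLIntegral_withDensity_eq_setLIntegral_mul _ hprod hf hDm,
    ← lintegral_indicator hDm]
  refine lintegral_congr fun x ↦ ?_
  by_cases hx : x ∈ D
  · have : ∀ θ : ι → T, J.indicator (fun p ↦ D.indicator f p.2) (θ, x)
        = {θ : ι → T | (θ, x) ∈ J}.indicator (fun _ ↦ f x) θ := by
      intro θ
      simp only [Set.indicator, Set.mem_ofPred_eq, if_pos hx]
    simp_rw [this]
    rw [lintegral_indicator_const (s := {θ : ι → T | (θ, x) ∈ J}) (measurable_prodMk_right hJ),
      Set.indicator_of_mem hx, Pi.mul_apply, mul_comm, ← pi_setOf_forall_mem τ K hx]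
    rfl
  · have : ∀ θ : ι → T, J.indicator (fun p ↦ D.indicator f p.2) (θ, x) = 0 := by
      intro θ
      simp [Set.indicator, hx]
    simp [this, hx]

/-- One half of the two-point argument: a test that accepts with probability at least `p` for every
choice of the parameters accepts, on distinct cells, under the averaged measure. -/
lemma le_lintegral_distinctCells_add {cell : E → ι} (hcell : Measurable cell) (τ : Measure T)
    [IsProbabilityMeasure τ] {K : Set (E × T)} (hK : MeasurableSet K) (N : Measure E)
    [IsFiniteMeasure N] (hN : ∀ θ, IsProbabilityMeasure (N.restrict (cellwiseSet cell K θ)))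
    {ν : Measure E} [IsProbabilityMeasure ν]
    (hν : N.withDensity (fun x ↦ τ {t | (x, t) ∈ K}) = ν) {m : ℕ}
    {f : (Fin m → E) → ℝ≥0∞} (hf : Measurable f) (hf1 : ∀ x, f x ≤ 1) {p : ℝ≥0∞}
    (hp : ∀ θ, p ≤ ∫⁻ x, f x ∂Measure.pi fun _ ↦ N.restrict (cellwiseSet cell K θ)) :
    p ≤ ∫⁻ x in distinctCells cell m, f x ∂(Measure.pi fun _ ↦ ν)
      + Measure.pi (fun _ ↦ ν) (distinctCells cell m)ᶜ := by
  set D := distinctCells cell m with hD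
  have hDm : MeasurableSet D := measurableSet_distinctCells hcell m
  let P : (ι → T) → Measure (Fin m → E) :=
    fun θ ↦ Measure.pi fun _ ↦ N.restrict (cellwiseSet cell K θ)
  have hP : ∀ θ, IsProbabilityMeasure (P θ) := fun θ ↦ inferInstance
  obtain ⟨hm, hmix⟩ := lintegral_cellwiseSet hcell τ hK N hf
  obtain ⟨hm1, hmix1⟩ := lintegral_cellwiseSet (m := m) hcell τ hK N measurable_one
  rw [hν] at hmix hmix1
  simp only [Pi.one_apply, lintegral_const, one_mul, Measure.restrict_apply_univ] at hm1 hmix1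
  rw [← hD] at hm1 hmix1
  -- the collision probabilities before and after averaging coincide
  have hcompl : ∫⁻ θ, P θ Dᶜ ∂(Measure.pi fun _ : ι ↦ τ) = Measure.pi (fun _ ↦ ν) Dᶜ := by
    have h₁ : ∫⁻ θ, P θ D ∂(Measure.pi fun _ : ι ↦ τ)
        + ∫⁻ θ, P θ Dᶜ ∂(Measure.pi fun _ : ι ↦ τ) = 1 := by
      rw [← lintegral_add_left hm1]
      calc _ = ∫⁻ _, 1 ∂(Measure.pi fun _ : ι ↦ τ) :=
            lintegral_congr fun θ ↦ prob_add_prob_compl (μ := P θ) hDm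
        _ = 1 := by simp
    rw [show ∫⁻ θ, P θ D ∂(Measure.pi fun _ : ι ↦ τ) = _ from hmix1,
      ← prob_add_prob_compl (μ := Measure.pi fun _ : Fin m ↦ ν) hDm] at h₁
    exact (ENNReal.add_right_inj (measure_ne_top _ _)).1 h₁
  calc p = ∫⁻ _, p ∂(Measure.pi fun _ : ι ↦ τ) := by simp
    _ ≤ ∫⁻ θ, (∫⁻ x in D, f x ∂P θ + P θ Dᶜ) ∂(Measure.pi fun _ : ι ↦ τ) := by
        refine lintegral_mono fun θ ↦ (hp θ).trans ?_
        rw [← lintegral_add_compl f hDm]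
        gcongr
        exact (lintegral_mono hf1).trans (by simp [P])
    _ = _ := by rw [lintegral_add_left hm, hmix, hcompl]

/-- The two-point lower bound. Two hypotheses `N₁`, `N₂` are truncated to random sets with the
same averaged measure `ν`; they cannot be told apart from samples in distinct cells. -/
theorem two_mul_le_of_estimator {cell : E → ι} (hcell : Measurable cell) (τ : Measure T)
    [IsProbabilityMeasure τ] {K₁ K₂ : Set (E × T)} (hK₁ : MeasurableSet K₁)
    (hK₂ : MeasurableSet K₂) (N₁ N₂ : Measure E) [IsFiniteMeasure N₁] [IsFiniteMeasure N₂]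
    (hN₁ : ∀ θ, IsProbabilityMeasure (N₁.restrict (cellwiseSet cell K₁ θ)))
    (hN₂ : ∀ θ, IsProbabilityMeasure (N₂.restrict (cellwiseSet cell K₂ θ)))
    {ν : Measure E} [IsProbabilityMeasure ν]
    (hν₁ : N₁.withDensity (fun x ↦ τ {t | (x, t) ∈ K₁}) = ν)
    (hν₂ : N₂.withDensity (fun x ↦ τ {t | (x, t) ∈ K₂}) = ν)
    (hν : ∀ j, ν (cell ⁻¹' {j}) = (Fintype.card ι : ℝ≥0∞)⁻¹)
    {F : Type*} [MeasurableSpace F] {m : ℕ} (A : Kernel (Fin m → E) F) [IsMarkovKernel A]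
    {B₁ B₂ : Set F} (hB₁ : MeasurableSet B₁) (hB₂ : MeasurableSet B₂) (hB : Disjoint B₁ B₂)
    {p : ℝ≥0∞}
    (hp₁ : ∀ θ, p ≤ ((Measure.pi fun _ ↦ N₁.restrict (cellwiseSet cell K₁ θ)).bind A) B₁)
    (hp₂ : ∀ θ, p ≤ ((Measure.pi fun _ ↦ N₂.restrict (cellwiseSet cell K₂ θ)).bind A) B₂) :
    p + p ≤ 1 + (m : ℝ≥0∞) ^ 2 * (Fintype.card ι : ℝ≥0∞)⁻¹ := by
  set D := distinctCells cell m with hD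
  have hDm : MeasurableSet D := measurableSet_distinctCells hcell m
  simp_rw [Measure.bind_apply hB₁ A.aemeasurable] at hp₁
  simp_rw [Measure.bind_apply hB₂ A.aemeasurable] at hp₂
  have h₁ := le_lintegral_distinctCells_add hcell τ hK₁ N₁ hN₁ hν₁ (A.measurable_coe hB₁)
    (fun _ ↦ prob_le_one) hp₁
  have h₂ := le_lintegral_distinctCells_add hcell τ hK₂ N₂ hN₂ hν₂ (A.measurable_coe hB₂)
    (fun _ ↦ prob_le_one) hp₂
  have h₃ : ∫⁻ x in D, A x B₁ ∂(Measure.pi fun _ ↦ ν) + ∫⁻ x in D, A x B₂ ∂(Measure.pi fun _ ↦ ν)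
      ≤ Measure.pi (fun _ ↦ ν) D := by
    rw [← lintegral_add_left (A.measurable_coe hB₁)]
    calc _ ≤ ∫⁻ x in D, 1 ∂(Measure.pi fun _ ↦ ν) := by
          refine lintegral_mono fun x ↦ ?_
          rw [← measure_union hB hB₂]
          exact prob_le_one
      _ = _ := by simp
  calc p + p ≤ _ := add_le_add h₁ h₂
    _ = (∫⁻ x in D, A x B₁ ∂(Measure.pi fun _ ↦ ν) + ∫⁻ x in D, A x B₂ ∂(Measure.pi fun _ ↦ ν))
        + Measure.pi (fun _ ↦ ν) Dᶜ + Measure.pi (fun _ ↦ ν) Dᶜ := by ring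
    _ ≤ Measure.pi (fun _ ↦ ν) D + Measure.pi (fun _ ↦ ν) Dᶜ + Measure.pi (fun _ ↦ ν) Dᶜ := by
        gcongr
    _ ≤ _ := by
        rw [prob_add_prob_compl hDm]
        gcongr
        exact pi_compl_distinctCells_le ν hν m

end Mixture

/-! ### The normal distribution on the line -/

section GaussianLine

lemma gaussianReal_le_volume (m : ℝ) : gaussianReal m 1 ≤ volume := by
  rw [gaussianReal_of_var_ne_zero m one_ne_zero]
  conv_rhs => rw [← withDensity_one (μ := (volume : Measure ℝ))]
  refine withDensity_mono (ae_of_all _ fun x ↦ ?_)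
  rw [gaussianPDF, Pi.one_apply, ENNReal.ofReal_le_one, gaussianPDFReal_def]
  have h₁ : Real.exp (-(x - m) ^ 2 / (2 * ((1 : ℝ≥0) : ℝ))) ≤ 1 := by
    rw [Real.exp_le_one_iff]
    have := sq_nonneg (x - m)
    simp only [NNReal.coe_one, mul_one]
    linarith
  have h₂ : (√(2 * Real.pi * ((1 : ℝ≥0) : ℝ)))⁻¹ ≤ 1 := by
    refine inv_le_one_of_one_le₀ (Real.one_le_sqrt.2 ?_)
    have := Real.pi_gt_three
    simp only [NNReal.coe_one, mul_one]
    linarith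
  exact mul_le_one₀ h₂ (Real.exp_nonneg _) h₁

/-- The distribution function of `N(0, 1)`. -/
noncomputable def gaussianCDF (t : ℝ) : ℝ := cdf (gaussianReal 0 1) t

lemma gaussianCDF_eq (t : ℝ) : gaussianCDF t = (gaussianReal 0 1).real (Set.Iic t) :=
  cdf_eq_real _ t

lemma gaussianCDF_sub {s t : ℝ} (h : s ≤ t) :
    gaussianCDF t - gaussianCDF s = (gaussianReal 0 1).real (Set.Ioc s t) := by
  rw [gaussianCDF_eq, gaussianCDF_eq,
    ← measureReal_sdiff (Set.Iic_subset_Iic.2 h) measurableSet_Iic]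
  congr 1
  ext r
  simp [and_comm]

lemma abs_gaussianCDF_sub_le (s t : ℝ) : |gaussianCDF s - gaussianCDF t| ≤ |s - t| := by
  have key : ∀ s t, s ≤ t → |gaussianCDF s - gaussianCDF t| ≤ |s - t| := by
    intro s t h
    rw [abs_sub_comm, abs_sub_comm s t, gaussianCDF_sub h, abs_of_nonneg measureReal_nonneg,
      abs_of_nonneg (sub_nonneg.2 h)]
    refine ENNReal.toReal_le_of_le_ofReal (sub_nonneg.2 h) ?_
    exact (gaussianReal_le_volume 0 _).trans (by rw [Real.volume_Ioc])
  rcases le_total s t with h | h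
  · exact key s t h
  · rw [abs_sub_comm, abs_sub_comm s t]
    exact key t s h

lemma continuous_gaussianCDF : Continuous gaussianCDF :=
  (LipschitzWith.of_dist_le_mul (K := 1) fun s t ↦ by
    simpa [Real.dist_eq] using abs_gaussianCDF_sub_le s t).continuous

lemma strictMono_gaussianCDF : StrictMono gaussianCDF := by
  intro s t h
  rw [← sub_pos, gaussianCDF_sub h.le, measureReal_def, ENNReal.toReal_pos_iff]
  refine ⟨pos_iff_ne_zero.2 fun h0 ↦ ?_, measure_lt_top _ _⟩
  have := gaussianReal_absolutelyContinuous' 0 one_ne_zero h0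
  rw [Real.volume_Ioc, ENNReal.ofReal_eq_zero] at this
  linarith

lemma gaussianCDF_pos (t : ℝ) : 0 < gaussianCDF t :=
  (cdf_nonneg (gaussianReal 0 1) (t - 1)).trans_lt (strictMono_gaussianCDF (sub_one_lt t))

lemma gaussianCDF_lt_one (t : ℝ) : gaussianCDF t < 1 :=
  (strictMono_gaussianCDF (lt_add_one t)).trans_le (cdf_le_one (gaussianReal 0 1) (t + 1))

/-- The probability integral transform. -/
lemma map_gaussianCDF :
    (gaussianReal 0 1).map gaussianCDF = volume.restrict (Set.Ioc (0 : ℝ) 1) := by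
  have hm := continuous_gaussianCDF.measurable
  have : IsProbabilityMeasure (volume.restrict (Set.Ioc (0 : ℝ) 1)) := ⟨by simp⟩
  have : IsProbabilityMeasure ((gaussianReal 0 1).map gaussianCDF) :=
    Measure.isProbabilityMeasure_map hm.aemeasurable
  refine Measure.ext_of_Iic _ _ fun a ↦ ?_
  rw [Measure.map_apply hm measurableSet_Iic, Measure.restrict_apply measurableSet_Iic]
  rcases le_or_gt a 0 with ha | ha
  · have h₁ : gaussianCDF ⁻¹' Set.Iic a = ∅ :=
      Set.eq_empty_of_forall_notMem fun t ht ↦ (ha.trans_lt (gaussianCDF_pos t)).not_ge ht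
    have h₂ : Set.Iic a ∩ Set.Ioc (0 : ℝ) 1 = ∅ :=
      Set.eq_empty_of_forall_notMem fun t ht ↦ (ha.trans_lt ht.2.1).not_ge ht.1
    rw [h₁, h₂, measure_empty, measure_empty]
  rcases le_or_gt 1 a with ha1 | ha1
  · have h₁ : gaussianCDF ⁻¹' Set.Iic a = Set.univ :=
      Set.eq_univ_of_forall fun t ↦ (gaussianCDF_lt_one t).le.trans ha1
    have h₂ : Set.Iic a ∩ Set.Ioc (0 : ℝ) 1 = Set.Ioc 0 1 :=
      Set.inter_eq_right.2 fun t ht ↦ ht.2.trans ha1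
    rw [h₁, h₂, measure_univ, Real.volume_Ioc]
    simp
  · obtain ⟨t₁, ht₁⟩ := ((tendsto_cdf_atBot (gaussianReal 0 1)).eventually_le_const ha).exists
    obtain ⟨t₂, ht₂⟩ := ((tendsto_cdf_atTop (gaussianReal 0 1)).eventually_const_le ha1).exists
    obtain ⟨t, ht⟩ := mem_range_of_exists_le_of_exists_ge continuous_gaussianCDF
      ⟨t₁, ht₁⟩ ⟨t₂, ht₂⟩
    have h₁ : gaussianCDF ⁻¹' Set.Iic a = Set.Iic t := by
      ext s
      rw [Set.mem_preimage, Set.mem_Iic, ← ht, strictMono_gaussianCDF.le_iff_le, Set.mem_Iic]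
    have h₂ : Set.Iic a ∩ Set.Ioc (0 : ℝ) 1 = Set.Ioc 0 a := by
      ext s
      simp only [Set.mem_inter_iff, Set.mem_Iic, Set.mem_Ioc]
      constructor
      · rintro ⟨h, h', -⟩; exact ⟨h', h⟩
      · rintro ⟨h, h'⟩; exact ⟨h', h, h'.trans ha1.le⟩
    rw [h₁, h₂, Real.volume_Ioc, sub_zero, ← ht, gaussianCDF, ofReal_cdf]

/-- Rotating the circle `ℝ / ℤ` preserves the uniform distribution. -/
lemma volume_fract_add_mem (b : ℝ) {J : Set ℝ} (hJ : MeasurableSet J) :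
    volume.restrict (Set.Ioc (0 : ℝ) 1) {s | Int.fract (s + b) ∈ J} = volume (J ∩ Set.Ico 0 1) := by
  have hA : MeasurableSet (Int.fract ⁻¹' J : Set ℝ) := measurable_fract hJ
  have hA' : MeasurableSet {s : ℝ | Int.fract (s + b) ∈ J} :=
    (measurable_fract.comp (measurable_add_const b)) hJ
  have hper : ∀ g : AddSubgroup.zmultiples (1 : ℝ),
      (fun x ↦ g +ᵥ x) ⁻¹' (Int.fract ⁻¹' J : Set ℝ) = Int.fract ⁻¹' J := by
    rintro ⟨g, k, rfl⟩
    ext x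
    simp [AddSubgroup.vadd_def, add_comm]
  have : VAddInvariantMeasure (AddSubgroup.zmultiples (1 : ℝ)) ℝ volume :=
    ⟨fun c s _ => measure_preimage_add _ _ _⟩
  have h₁ : volume (Int.fract ⁻¹' J ∩ Set.Ioc b (b + 1))
      = volume (Int.fract ⁻¹' J ∩ Set.Ioc (0 : ℝ) (0 + 1)) :=
    (isAddFundamentalDomain_Ioc one_pos b).measure_set_eq
      (isAddFundamentalDomain_Ioc one_pos 0) hA hper
  have h₂ : volume ({s : ℝ | Int.fract (s + b) ∈ J} ∩ Set.Ioc (0 : ℝ) 1)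
      = volume (Int.fract ⁻¹' J ∩ Set.Ioc b (b + 1)) := by
    rw [← measure_preimage_add_right volume b (Int.fract ⁻¹' J ∩ Set.Ioc b (b + 1))]
    congr 1
    ext s
    simp only [Set.mem_inter_iff, Set.mem_ofPred_eq, Set.mem_Ioc, Set.mem_preimage]
    constructor
    · rintro ⟨h, h', h''⟩; exact ⟨h, by linarith, by linarith⟩
    · rintro ⟨h, h', h''⟩; exact ⟨h, by linarith, by linarith⟩
  have h₃ : volume (Int.fract ⁻¹' J ∩ Set.Ioc (0 : ℝ) 1) = volume (J ∩ Set.Ico 0 1) := by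
    refine (measure_congr ((ae_eq_refl _).inter Ico_ae_eq_Ioc.symm)).trans ?_
    congr 1
    ext s
    simp only [Set.mem_inter_iff, Set.mem_preimage]
    exact and_congr_left fun h ↦ by rw [Int.fract_eq_self.2 h]
  rw [Measure.restrict_apply hA', h₂, h₁, zero_add, h₃]

lemma gaussianReal_fract_gaussianCDF_add_mem (b : ℝ) {J : Set ℝ} (hJ : MeasurableSet J) :
    gaussianReal 0 1 {t | Int.fract (gaussianCDF t + b) ∈ J} = volume (J ∩ Set.Ico 0 1) := by
  rw [← volume_fract_add_mem b hJ, ← map_gaussianCDF,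
    Measure.map_apply continuous_gaussianCDF.measurable]
  · rfl
  · exact (measurable_fract.comp (measurable_add_const b)) hJ

lemma volume_Iio_inter_Ico {q : ℝ} (hq : q ≤ 1) :
    volume (Set.Iio q ∩ Set.Ico (0 : ℝ) 1) = ENNReal.ofReal q := by
  have : Set.Iio q ∩ Set.Ico (0 : ℝ) 1 = Set.Ico 0 q := by
    ext s
    simp only [Set.mem_inter_iff, Set.mem_Iio, Set.mem_Ico]
    constructor
    · rintro ⟨h, h', -⟩; exact ⟨h', h⟩
    · rintro ⟨h, h'⟩; exact ⟨h', h, h'.trans_le hq⟩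
  rw [this, Real.volume_Ico, sub_zero]

/-- Thinning `N(2, 1)` with the likelihood ratio `φ₂ / (φ₁ + φ₂)` and `N(-2, 1)` with the ratio
`φ₁ / (φ₁ + φ₂)` gives the same measure, of density `φ₁ φ₂ / (φ₁ + φ₂)`. -/
lemma gaussianReal_withDensity_sigmoid :
    (gaussianReal 2 1).withDensity (fun x ↦ ENNReal.ofReal (Real.sigmoid (-4 * x)))
      = (gaussianReal (-2) 1).withDensity (fun x ↦ ENNReal.ofReal (1 - Real.sigmoid (-4 * x))) := by
  have hm : Measurable fun x : ℝ ↦ Real.sigmoid (-4 * x) :=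
    continuous_sigmoid.measurable.comp (measurable_const_mul (-4 : ℝ))
  rw [gaussianReal_of_var_ne_zero _ one_ne_zero, gaussianReal_of_var_ne_zero _ one_ne_zero,
    ← withDensity_mul _ (measurable_gaussianPDF _ _) hm.ennreal_ofReal,
    ← withDensity_mul _ (measurable_gaussianPDF _ _) (hm.const_sub 1).ennreal_ofReal]
  congr 1
  ext x
  simp only [Pi.mul_apply, gaussianPDF]
  rw [← ENNReal.ofReal_mul (gaussianPDFReal_nonneg _ _ _),
    ← ENNReal.ofReal_mul (gaussianPDFReal_nonneg _ _ _), ← Real.sigmoid_neg,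
    ← Real.sigmoid_mul_rexp_neg (-4 * x)]
  congr 1
  simp only [gaussianPDFReal_def]
  have : Real.exp (-(x - 2) ^ 2 / (2 * ((1 : ℝ≥0) : ℝ)))
      = Real.exp (-(x - -2) ^ 2 / (2 * ((1 : ℝ≥0) : ℝ))) * Real.exp (-(-4 * x)) := by
    rw [← Real.exp_add]
    congr 1
    simp only [NNReal.coe_one]
    ring
  rw [this]
  ring

lemma abs_sigmoid_sub_le (s t : ℝ) :
    |Real.sigmoid (-4 * s) - Real.sigmoid (-4 * t)| ≤ |s - t| := by
  have hd : ∀ x ∈ (Set.univ : Set ℝ), HasDerivWithinAt Real.sigmoid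
      (Real.sigmoid x * (1 - Real.sigmoid x)) Set.univ x :=
    fun x _ ↦ (Real.hasDerivAt_sigmoid x).hasDerivWithinAt
  have hb : ∀ x ∈ (Set.univ : Set ℝ), ‖Real.sigmoid x * (1 - Real.sigmoid x)‖ ≤ 1 / 4 := by
    intro x _
    rw [Real.norm_eq_abs, abs_of_nonneg (mul_nonneg (Real.sigmoid_nonneg x)
      (sub_nonneg.2 (Real.sigmoid_le_one x)))]
    nlinarith [sq_nonneg (Real.sigmoid x - 1 / 2)]
  have := convex_univ.norm_image_sub_le_of_norm_hasDerivWithin_le hd hb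
    (Set.mem_univ (-4 * t)) (Set.mem_univ (-4 * s))
  rw [Real.norm_eq_abs, Real.norm_eq_abs, ← mul_sub, abs_mul] at this
  norm_num at this
  rw [show (-4 : ℝ) * s = -(4 * s) by ring, show (-4 : ℝ) * t = -(4 * t) by ring]
  linarith

end GaussianLine

/-! ### The normal distribution on Euclidean space -/

section GaussianSpace

lemma normalId_eq_map_pi (d : ℕ) (μ : EuclideanSpace ℝ (Fin d)) :
    normalId d μ = (Measure.pi fun i ↦ gaussianReal (μ i) 1).map (WithLp.toLp 2) := by
  have h₁ : normalId d μ = (stdGaussian (EuclideanSpace ℝ (Fin d))).map (fun x ↦ μ + x) := by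
    simp [normalId, multivariateGaussian]
  have h₂ : (Measure.pi fun i ↦ gaussianReal (μ i) 1)
      = (Measure.pi fun _ : Fin d ↦ gaussianReal 0 1).map fun x i ↦ μ i + x i := by
    rw [Measure.pi_map_pi fun i ↦ (measurable_const_add _).aemeasurable]
    simp [gaussianReal_map_const_add]
  rw [h₁, h₂, ← map_pi_eq_stdGaussian, Measure.map_map (by fun_prop) (by fun_prop),
    Measure.map_map (by fun_prop) (by fun_prop)]
  congr 1

instance isProbabilityMeasure_normalId (d : ℕ) (μ : EuclideanSpace ℝ (Fin d)) :
    IsProbabilityMeasure (normalId d μ) := by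
  unfold normalId; infer_instance

/-- Replacing the `i`-th coordinate of `x` by `t`. -/
def replaceCoord {d : ℕ} (x : EuclideanSpace ℝ (Fin d)) (i : Fin d) (t : ℝ) :
    EuclideanSpace ℝ (Fin d) :=
  WithLp.toLp 2 (Function.update x.ofLp i t)

lemma replaceCoord_self {d : ℕ} (x : EuclideanSpace ℝ (Fin d)) (i : Fin d) (t : ℝ) :
    replaceCoord x i t i = t := by
  simp [replaceCoord]

lemma replaceCoord_of_ne {d : ℕ} (x : EuclideanSpace ℝ (Fin d)) {i j : Fin d} (h : j ≠ i)
    (t : ℝ) : replaceCoord x i t j = x j := by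
  simp [replaceCoord, h]

/-- Fubini's theorem for the normal distribution, in the form that singles out one coordinate. -/
lemma normalId_eq_lintegral_replaceCoord {d : ℕ} (μ : EuclideanSpace ℝ (Fin d)) (i : Fin d)
    {S : Set (EuclideanSpace ℝ (Fin d))} (hS : MeasurableSet S) :
    normalId d μ S
      = ∫⁻ x, gaussianReal (μ i) 1 {t | replaceCoord x i t ∈ S} ∂normalId d μ := by
  have hl : Measurable (WithLp.toLp 2 : (Fin d → ℝ) → EuclideanSpace ℝ (Fin d)) := by fun_prop
  have hup := measurePreserving_update (fun j ↦ gaussianReal (μ j) 1) i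
  rw [normalId_eq_map_pi, Measure.map_apply hl hS,
    show (WithLp.toLp 2 : (Fin d → ℝ) → EuclideanSpace ℝ (Fin d))
      = MeasurableEquiv.toLp 2 (Fin d → ℝ) from rfl, lintegral_map_equiv]
  refine (hup.measure_preimage (hl hS).nullMeasurableSet).symm.trans ?_
  rw [Measure.prod_apply (hup.measurable (hl hS))]
  rfl

lemma normalId_map_coord {d : ℕ} (μ : EuclideanSpace ℝ (Fin d)) (i : Fin d) :
    (normalId d μ).map (fun x ↦ x i) = gaussianReal (μ i) 1 := by
  have := (measurePreserving_eval_multivariateGaussian (μ := μ) Matrix.PosSemidef.one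
    (i := i)).map_eq
  simpa [normalId] using this

end GaussianSpace

/-! ### Gaussian surface area -/

section SurfaceArea

/-- To bound the surface area it suffices to control the points outside `S` that have points of `S`
within distance `2 δ`; the factor `2` replaces the closed neighbourhood by an open one. -/
lemma gaussianSurfaceArea_le {d : ℕ} {S : Set (EuclideanSpace ℝ (Fin d))} {C : ℝ}
    (B : ℝ → Set (EuclideanSpace ℝ (Fin d)))
    (hB : ∀ δ > 0, ∀ x ∉ S, ∀ y ∈ S, dist x y < 2 * δ → x ∈ B δ)
    (hm : ∀ δ > 0, normalId d 0 (B δ) ≤ ENNReal.ofReal (C * δ)) :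
    gaussianSurfaceArea d S ≤ ENNReal.ofReal C := by
  refine liminf_le_of_frequently_le' (Eventually.frequently ?_)
  filter_upwards [self_mem_nhdsWithin] with δ (hδ : 0 < δ)
  refine ENNReal.div_le_of_le_mul ?_
  rw [← ENNReal.ofReal_mul' hδ.le]
  refine (measure_mono fun x hx ↦ ?_).trans (hm δ hδ)
  obtain ⟨y, hy, hxy⟩ := Metric.mem_thickening_iff.1
    (Metric.cthickening_subset_thickening' (by linarith) (by linarith : δ < 2 * δ) S hx.1)
  exact hB δ hδ x hx.2 y hy hxy

lemma abs_coord_sub_le_dist {d : ℕ} (x y : EuclideanSpace ℝ (Fin d)) (i : Fin d) :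
    |x i - y i| ≤ dist x y := by
  rw [dist_eq_norm, ← PiLp.sub_apply, ← Real.norm_eq_abs]
  exact PiLp.norm_apply_le (x - y) i

/-- The points within `r` of one of the coordinate hyperplanes. -/
def nearHyperplane (d : ℕ) (r : ℝ) : Set (EuclideanSpace ℝ (Fin d)) := {x | ∃ i, |x i| ≤ r}

lemma mem_nearHyperplane_of_sign_ne {d : ℕ} {x y : EuclideanSpace ℝ (Fin d)} {r : ℝ}
    (h : dist x y < r) (i : Fin d) (hi : decide (0 < x i) ≠ decide (0 < y i)) :
    x ∈ nearHyperplane d r := by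
  have h₁ := (abs_coord_sub_le_dist x y i).trans_lt h
  rw [abs_lt] at h₁
  have h₂ : ¬(0 < x i ↔ 0 < y i) := fun h ↦ hi (decide_eq_decide.2 h)
  refine ⟨i, abs_le.2 ?_⟩
  by_cases hx : 0 < x i
  · have : ¬ 0 < y i := fun hy ↦ h₂ ⟨fun _ ↦ hy, fun _ ↦ hx⟩
    constructor <;> linarith
  · have : 0 < y i := by
      by_contra hy
      exact h₂ ⟨fun h ↦ absurd h hx, fun h ↦ absurd h hy⟩
    constructor <;> linarith

lemma normalId_nearHyperplane_le (d : ℕ) (δ : ℝ) :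
    normalId d 0 (nearHyperplane d (2 * δ)) ≤ ENNReal.ofReal (4 * d * δ) := by
  have h₁ : nearHyperplane d (2 * δ)
      = ⋃ i : Fin d, (fun x : EuclideanSpace ℝ (Fin d) ↦ x i) ⁻¹' Set.Icc (-(2 * δ)) (2 * δ) := by
    ext x
    simp [nearHyperplane, abs_le]
  rw [h₁]
  refine (measure_iUnion_le _).trans ?_
  have h₂ : ∀ i : Fin d, normalId d 0
      ((fun x : EuclideanSpace ℝ (Fin d) ↦ x i) ⁻¹' Set.Icc (-(2 * δ)) (2 * δ))
        ≤ ENNReal.ofReal (4 * δ) := by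
    intro i
    rw [← Measure.map_apply (by fun_prop) measurableSet_Icc, normalId_map_coord]
    refine (gaussianReal_le_volume _ _).trans ?_
    rw [Real.volume_Icc]
    exact ENNReal.ofReal_le_ofReal (by linarith)
  rw [tsum_fintype]
  refine (Finset.sum_le_sum fun i _ ↦ h₂ i).trans ?_
  rw [Finset.sum_const, Finset.card_univ, Fintype.card_fin, nsmul_eq_mul, ← ENNReal.ofReal_natCast,
    ← ENNReal.ofReal_mul (by positivity)]
  exact ENNReal.ofReal_le_ofReal (by linarith)

end SurfaceArea

/-! ### Unions of orthants -/

section Orthants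

/-- The signs of the coordinates, which index the orthants. -/
noncomputable def orthantIndex {d : ℕ} (x : EuclideanSpace ℝ (Fin d)) : Fin d → Bool :=
  fun i ↦ decide (0 < x i)

/-- The family of all unions of orthants. -/
def orthantUnions (d : ℕ) : Set (Set (EuclideanSpace ℝ (Fin d))) :=
  Set.range fun 𝒜 : Set (Fin d → Bool) ↦ orthantIndex ⁻¹' 𝒜

lemma measurable_decide_pos {d : ℕ} (i : Fin d) :
    Measurable fun x : EuclideanSpace ℝ (Fin d) ↦ decide (0 < x i) := by
  refine measurable_to_bool ?_
  have : (fun x : EuclideanSpace ℝ (Fin d) ↦ decide (0 < x i)) ⁻¹' {true} = {x | 0 < x i} := by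
    ext x; simp
  rw [this]
  exact measurableSet_lt measurable_const (by fun_prop)

lemma measurableSet_of_mem_orthantUnions {d : ℕ} {S : Set (EuclideanSpace ℝ (Fin d))}
    (hS : S ∈ orthantUnions d) : MeasurableSet S := by
  obtain ⟨𝒜, rfl⟩ := hS
  have : Measurable (orthantIndex (d := d)) :=
    measurable_pi_lambda _ fun i ↦ measurable_decide_pos i
  exact this 𝒜.toFinite.measurableSet

lemma gaussianSurfaceArea_le_of_mem_orthantUnions {d : ℕ} {S : Set (EuclideanSpace ℝ (Fin d))}
    (hS : S ∈ orthantUnions d) : gaussianSurfaceArea d S ≤ ENNReal.ofReal (4 * d) := by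
  obtain ⟨𝒜, rfl⟩ := hS
  refine gaussianSurfaceArea_le (fun δ ↦ nearHyperplane d (2 * δ)) (fun δ _ x hx y hy hxy ↦ ?_)
    fun δ _ ↦ normalId_nearHyperplane_le d δ
  have : orthantIndex x ≠ orthantIndex y := fun h ↦ hx <| by
    rw [Set.mem_preimage, h]; exact hy
  obtain ⟨i, hi⟩ := Function.ne_iff.1 this
  exact mem_nearHyperplane_of_sign_ne hxy i hi

lemma le_familyVCDim_orthantUnions (d : ℕ) :
    ((2 ^ d : ℕ) : ℕ∞) ≤ familyVCDim (orthantUnions d) := by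
  classical
  let v : (Fin d → Bool) → EuclideanSpace ℝ (Fin d) :=
    fun b ↦ WithLp.toLp 2 fun i ↦ if b i then 1 else -1
  have hv : ∀ b, orthantIndex (v b) = b := by
    intro b
    ext i
    cases h : b i <;> simp [orthantIndex, v, h]
  have hinj : Function.Injective v := fun b c h ↦ by rw [← hv b, h, hv c]
  have hX : FamilyShatters (orthantUnions d) (Finset.univ.image v) := by
    intro Y hY
    refine ⟨_, ⟨v ⁻¹' Y, rfl⟩, Set.ext fun x ↦ ?_⟩
    constructor
    · rintro ⟨hx, hx'⟩
      obtain ⟨b, -, rfl⟩ := Finset.mem_image.1 (Finset.mem_coe.1 hx)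
      simpa [hv] using hx'
    · intro hx
      obtain ⟨b, -, rfl⟩ := Finset.mem_image.1 (hY (Finset.mem_coe.1 hx))
      exact ⟨by simp, by simpa [hv] using hx⟩
  have := hX.card_le_familyVCDim
  rwa [Finset.card_image_of_injective _ hinj, Finset.card_univ, Fintype.card_pi_const,
    Fintype.card_bool] at this

end Orthants

/-! ### The band family: measurability, VC dimension and surface area -/

section BandSets

/-- The cell of a point: the signs of all coordinates but the first three. -/
noncomputable def signCell {n : ℕ} (x : EuclideanSpace ℝ (Fin (n + 3))) : Fin n → Bool :=
  fun i ↦ decide (0 < x i.succ.succ.succ)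

/-- The band: the coordinate `x 0` is mapped to the circle `ℝ / ℤ` by the distribution function of
`N(0, 1)`, and `(x, t)` belongs to the band if the result, rotated by `t`, falls into the arc
`[0, sigmoid (-4 * x 1))`. -/
def band (n : ℕ) : Set (EuclideanSpace ℝ (Fin (n + 3)) × ℝ) :=
  {p | Int.fract (gaussianCDF (p.1 0) + p.2) < Real.sigmoid (-4 * p.1 1)}

/-- The sets that agree in each cell with a rotated band, and their complements. -/
def bandFamily (n : ℕ) : Set (Set (EuclideanSpace ℝ (Fin (n + 3)))) :=
  Set.range (cellwiseSet signCell (band n)) ∪ Set.range (cellwiseSet signCell (band n)ᶜ)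

lemma measurable_signCell {n : ℕ} : Measurable (signCell (n := n)) :=
  measurable_pi_lambda _ fun i ↦ measurable_decide_pos i.succ.succ.succ

lemma measurable_sigmoid_coord {d : ℕ} (i : Fin d) :
    Measurable fun x : EuclideanSpace ℝ (Fin d) ↦ Real.sigmoid (-4 * x i) :=
  continuous_sigmoid.measurable.comp (by fun_prop)

lemma measurable_gaussianCDF_coord {d : ℕ} (i : Fin d) :
    Measurable fun x : EuclideanSpace ℝ (Fin d) ↦ gaussianCDF (x i) :=
  continuous_gaussianCDF.measurable.comp (by fun_prop)

lemma measurableSet_band (n : ℕ) : MeasurableSet (band n) :=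
  measurableSet_lt (measurable_fract.comp
      (((measurable_gaussianCDF_coord 0).comp measurable_fst).add measurable_snd))
    ((measurable_sigmoid_coord 1).comp measurable_fst)

lemma measurableSet_of_mem_bandFamily {n : ℕ} {S : Set (EuclideanSpace ℝ (Fin (n + 3)))}
    (hS : S ∈ bandFamily n) : MeasurableSet S := by
  rcases hS with ⟨θ, rfl⟩ | ⟨θ, rfl⟩
  · exact measurableSet_cellwiseSet measurable_signCell (measurableSet_band n) θ
  · exact measurableSet_cellwiseSet measurable_signCell (measurableSet_band n).compl θ

/-- Membership of a fixed point in the rotated band compares the rotation with three thresholds. -/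
lemma fract_add_lt_iff {u q θ : ℝ} (hu₀ : 0 < u) (hu₁ : u < 1) (hq : q ≤ 1) :
    Int.fract (u + θ) < q ↔
      Int.fract θ < q - u ∨ (1 - u ≤ Int.fract θ ∧ Int.fract θ < 1 - u + q) := by
  have h₀ := Int.fract_nonneg θ
  have h₁ := Int.fract_lt_one θ
  have h : Int.fract (u + θ) = Int.fract (u + Int.fract θ) := by
    conv_lhs => rw [← Int.fract_add_floor θ, ← add_assoc, Int.fract_add_intCast]
  rw [h]
  rcases lt_or_ge (u + Int.fract θ) 1 with hc | hc
  · rw [Int.fract_eq_self.2 ⟨by linarith, hc⟩]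
    constructor
    · intro h; left; linarith
    · rintro (h | h)
      · linarith
      · linarith [h.1]
  · have : Int.fract (u + Int.fract θ) = u + Int.fract θ - 1 := by
      rw [← Int.fract_sub_one, Int.fract_eq_self.2 ⟨by linarith, by linarith⟩]
    rw [this]
    constructor
    · intro h; right; constructor <;> linarith
    · rintro (h | h)
      · linarith
      · linarith [h.2]

lemma familyVCDim_bandFamily_le (n : ℕ) : familyVCDim (bandFamily n) ≤ (2 ^ (n + 3) : ℕ) := by
  classical
  have h8 : (2 ^ (n + 3) : ℕ) = 8 * Fintype.card (Fin n → Bool) := by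
    rw [Fintype.card_pi_const, Fintype.card_bool, pow_add]; ring
  rw [h8]
  refine familyVCDim_le_of_cells signCell fun j X hXj hX ↦ ?_
  let u : EuclideanSpace ℝ (Fin (n + 3)) → ℝ := fun x ↦ gaussianCDF (x 0)
  let q : EuclideanSpace ℝ (Fin (n + 3)) → ℝ := fun x ↦ Real.sigmoid (-4 * x 1)
  let T : ℝ → Set (EuclideanSpace ℝ (Fin (n + 3))) :=
    fun s ↦ {x | s < q x - u x ∨ (1 - u x ≤ s ∧ s < 1 - u x + q x)}
  have hT : ∀ x ∈ X, ∀ θ : (Fin n → Bool) → ℝ,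
      x ∈ cellwiseSet signCell (band n) θ ↔ x ∈ T (Int.fract (θ j)) := by
    intro x hx θ
    rw [← hXj x hx]
    exact fract_add_lt_iff (gaussianCDF_pos _) (gaussianCDF_lt_one _) (Real.sigmoid_le_one _)
  refine card_le_of_thresholds T (fun x ↦ {q x - u x, 1 - u x, 1 - u x + q x})
    (fun x ↦ Finset.card_le_three) (fun x s s' h ↦ ?_) X fun Y hY ↦ ?_
  · have h₁ := h (q x - u x) (by simp)
    have h₂ := h (1 - u x) (by simp)
    have h₃ := h (1 - u x + q x) (by simp)
    change (s < q x - u x ∨ (1 - u x ≤ s ∧ s < 1 - u x + q x)) ↔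
      (s' < q x - u x ∨ (1 - u x ≤ s' ∧ s' < 1 - u x + q x))
    rw [← not_le, ← not_le, ← not_le, ← not_le, h₁, h₂, h₃]
  · obtain ⟨S, hS, e⟩ := hX Y hY
    rcases hS with ⟨θ, rfl⟩ | ⟨θ, rfl⟩
    · refine ⟨Int.fract (θ j), Or.inl ?_⟩
      rw [← e]
      exact Set.ext fun x ↦ and_congr_right fun hx ↦ (hT x hx θ).symm
    · refine ⟨Int.fract (θ j), Or.inr ?_⟩
      rw [← e]
      exact Set.ext fun x ↦ and_congr_right fun hx ↦ not_congr (hT x hx θ).symm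

/-- If a small perturbation changes whether a point of the circle lies in an arc `[0, q)`, then the
point is near one of the ends of the arc. -/
lemma fract_near_of_mem_ne {v w q q' ε : ℝ} (h : ¬(Int.fract v < q ↔ Int.fract w < q'))
    (hvw : |v - w| ≤ ε) (hq : |q - q'| ≤ ε) :
    Int.fract v ≤ ε ∨ 1 - ε ≤ Int.fract v ∨ |Int.fract v - q| ≤ 2 * ε := by
  have hv := Int.floor_add_fract v
  have hw := Int.floor_add_fract w
  have hv₀ := Int.fract_nonneg v
  have hw₀ := Int.fract_nonneg w
  have hw₁ := Int.fract_lt_one w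
  rw [abs_le] at hvw hq
  rcases lt_trichotomy ⌊v⌋ ⌊w⌋ with hf | hf | hf
  · right; left
    have : (⌊v⌋ : ℝ) + 1 ≤ ⌊w⌋ := by exact_mod_cast hf
    linarith
  · right; right
    rw [hf] at hv
    rw [abs_le]
    by_cases h₁ : Int.fract v < q
    · have : ¬ Int.fract w < q' := fun h₂ ↦ h ⟨fun _ ↦ h₂, fun _ ↦ h₁⟩
      constructor <;> linarith
    · have : Int.fract w < q' := by
        by_contra h₂
        exact h ⟨fun h ↦ absurd h h₁, fun h ↦ absurd h h₂⟩
      constructor <;> linarith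
  · left
    have : (⌊w⌋ : ℝ) + 1 ≤ ⌊v⌋ := by exact_mod_cast hf
    linarith

/-- The `2 δ`-neighbourhood, on the circle, of the end points of the arc `[0, q)`. -/
def nearArcEnds (δ q : ℝ) : Set ℝ :=
  Set.Iic (2 * δ) ∪ (Set.Ici (1 - 2 * δ) ∪ Set.Icc (q - 4 * δ) (q + 4 * δ))

lemma measurableSet_nearArcEnds (δ q : ℝ) : MeasurableSet (nearArcEnds δ q) :=
  measurableSet_Iic.union (measurableSet_Ici.union measurableSet_Icc)

lemma volume_nearArcEnds_le {δ : ℝ} (hδ : 0 < δ) (q : ℝ) :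
    volume (nearArcEnds δ q ∩ Set.Ico 0 1) ≤ ENNReal.ofReal (12 * δ) := by
  have hsub : nearArcEnds δ q ∩ Set.Ico 0 1 ⊆
      Set.Icc 0 (2 * δ) ∪ (Set.Icc (1 - 2 * δ) 1 ∪ Set.Icc (q - 4 * δ) (q + 4 * δ)) := by
    rintro r ⟨h | h | h, h₀, h₁⟩
    · exact Or.inl ⟨h₀, h⟩
    · exact Or.inr (Or.inl ⟨h, h₁.le⟩)
    · exact Or.inr (Or.inr h)
  refine (measure_mono hsub).trans ((measure_union_le _ _).trans
    ((add_le_add_right (measure_union_le _ _) _).trans ?_))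
  rw [Real.volume_Icc, Real.volume_Icc, Real.volume_Icc,
    ← ENNReal.ofReal_add (by linarith) (by linarith),
    ← ENNReal.ofReal_add (by linarith) (by linarith)]
  exact ENNReal.ofReal_le_ofReal (by linarith)

lemma signCell_replaceCoord_zero {n : ℕ} (x : EuclideanSpace ℝ (Fin (n + 3))) (t : ℝ) :
    signCell (replaceCoord x 0 t) = signCell x := by
  ext i
  simp [signCell, replaceCoord_of_ne x (Fin.succ_ne_zero i.succ.succ)]

lemma gaussianSurfaceArea_cellwiseSet_band_le {n : ℕ} (θ : (Fin n → Bool) → ℝ)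
    {S : Set (EuclideanSpace ℝ (Fin (n + 3)))}
    (hS : S = cellwiseSet signCell (band n) θ ∨ S = (cellwiseSet signCell (band n) θ)ᶜ) :
    gaussianSurfaceArea (n + 3) S ≤ ENNReal.ofReal (16 * (n + 3 : ℕ)) := by
  let r : EuclideanSpace ℝ (Fin (n + 3)) → ℝ :=
    fun x ↦ Int.fract (gaussianCDF (x 0) + θ (signCell x))
  let q : EuclideanSpace ℝ (Fin (n + 3)) → ℝ := fun x ↦ Real.sigmoid (-4 * x 1)
  have hr : Measurable r := measurable_fract.comp ((measurable_gaussianCDF_coord 0).add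
    ((Measurable.of_discrete (f := θ)).comp measurable_signCell))
  have hq : Measurable q := measurable_sigmoid_coord 1
  let G : ℝ → Set (EuclideanSpace ℝ (Fin (n + 3))) := fun δ ↦ {x | r x ∈ nearArcEnds δ (q x)}
  refine gaussianSurfaceArea_le (fun δ ↦ nearHyperplane (n + 3) (2 * δ) ∪ G δ)
    (fun δ hδ x hx y hy hxy ↦ ?_) fun δ hδ ↦ ?_
  · by_cases hc : signCell x = signCell y
    · right
      have hne : ¬(r x < q x ↔ r y < q y) := by
        intro h
        have h' : x ∈ cellwiseSet signCell (band n) θ ↔ y ∈ cellwiseSet signCell (band n) θ := h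
        rcases hS with rfl | rfl
        · exact hx (h'.2 hy)
        · exact hx fun hx' ↦ hy (h'.1 hx')
      have h₁ : |gaussianCDF (x 0) + θ (signCell x) - (gaussianCDF (y 0) + θ (signCell y))|
          ≤ 2 * δ := by
        rw [hc, add_sub_add_right_eq_sub]
        exact (abs_gaussianCDF_sub_le _ _).trans ((abs_coord_sub_le_dist x y 0).trans hxy.le)
      have h₂ : |q x - q y| ≤ 2 * δ :=
        (abs_sigmoid_sub_le _ _).trans ((abs_coord_sub_le_dist x y 1).trans hxy.le)
      rcases fract_near_of_mem_ne hne h₁ h₂ with h | h | h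
      · exact Or.inl h
      · exact Or.inr (Or.inl h)
      · rw [abs_le] at h
        exact Or.inr (Or.inr ⟨by linarith [h.1], by linarith [h.2]⟩)
    · left
      obtain ⟨i, hi⟩ := Function.ne_iff.1 hc
      exact mem_nearHyperplane_of_sign_ne hxy _ hi
  · have hG : MeasurableSet (G δ) := by
      have : G δ = {x | r x ≤ 2 * δ} ∪ ({x | 1 - 2 * δ ≤ r x} ∪
          ({x | q x - 4 * δ ≤ r x} ∩ {x | r x ≤ q x + 4 * δ})) := rfl
      rw [this]
      exact (measurableSet_le hr measurable_const).union <|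
        (measurableSet_le measurable_const hr).union <|
        (measurableSet_le (hq.sub_const _) hr).inter (measurableSet_le hr (hq.add_const _))
    have hG' : normalId (n + 3) 0 (G δ) ≤ ENNReal.ofReal (12 * δ) := by
      rw [normalId_eq_lintegral_replaceCoord 0 0 hG]
      calc _ ≤ ∫⁻ _, ENNReal.ofReal (12 * δ) ∂normalId (n + 3) 0 := by
            refine lintegral_mono fun x ↦ ?_
            have : {t | replaceCoord x 0 t ∈ G δ}
                = {t | Int.fract (gaussianCDF t + θ (signCell x)) ∈ nearArcEnds δ (q x)} := by
              ext t
              simp only [G, r, q, Set.mem_ofPred_eq, replaceCoord_self, signCell_replaceCoord_zero,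
                replaceCoord_of_ne x (one_ne_zero : (1 : Fin (n + 3)) ≠ 0)]
            rw [this]
            exact (gaussianReal_fract_gaussianCDF_add_mem _
              (measurableSet_nearArcEnds _ _)).trans_le (volume_nearArcEnds_le hδ _)
        _ = _ := by simp
    refine (measure_union_le _ _).trans
      ((add_le_add (normalId_nearHyperplane_le _ δ) hG').trans ?_)
    rw [← ENNReal.ofReal_add (by positivity) (by positivity)]
    refine ENNReal.ofReal_le_ofReal ?_
    push_cast
    nlinarith [mul_nonneg (Nat.cast_nonneg (α := ℝ) n) hδ.le]

lemma gaussianSurfaceArea_le_of_mem_bandFamily {n : ℕ} {S : Set (EuclideanSpace ℝ (Fin (n + 3)))}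
    (hS : S ∈ bandFamily n) :
    gaussianSurfaceArea (n + 3) S ≤ ENNReal.ofReal (16 * (n + 3 : ℕ)) := by
  rcases hS with ⟨θ, rfl⟩ | ⟨θ, rfl⟩
  · exact gaussianSurfaceArea_cellwiseSet_band_le θ (Or.inl rfl)
  · exact gaussianSurfaceArea_cellwiseSet_band_le θ (Or.inr rfl)

end BandSets

/-! ### The two truncated normal distributions -/

section TwoHypotheses

lemma gaussianReal_setOf_decide_pos (b : Bool) :
    gaussianReal 0 1 {t | decide (0 < t) = b} = 2⁻¹ := by
  have : NullSingletonClass (gaussianReal 0 1) := nullSingletonClass_gaussianReal one_ne_zero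
  have hneg : gaussianReal 0 1 (Set.Iic 0) = gaussianReal 0 1 (Set.Ioi 0) := by
    have h := congrArg (fun ρ : Measure ℝ ↦ ρ (Set.Iic 0)) (gaussianReal_map_neg (μ := 0) (v := 1))
    simp only [neg_zero] at h
    rw [← h, Measure.map_apply measurable_neg measurableSet_Iic]
    refine Eq.trans ?_ (measure_congr Ioi_ae_eq_Ici).symm
    congr 1
    ext t
    simp
  have hsum : gaussianReal 0 1 (Set.Ioi 0) + gaussianReal 0 1 (Set.Ioi 0) = 1 := by
    have h := prob_add_prob_compl (μ := gaussianReal 0 1) (measurableSet_Iic (a := (0 : ℝ)))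
    rwa [Set.compl_Iic, hneg] at h
  have hhalf : gaussianReal 0 1 (Set.Ioi 0) = 2⁻¹ := by
    rw [← two_mul] at hsum
    exact ENNReal.eq_inv_of_mul_eq_one_left (by rwa [mul_comm])
  cases b
  · rw [← hhalf, ← hneg]; congr 1; ext t; simp
  · rw [← hhalf]; congr 1; ext t; simp

/-- Weighting the normal distribution by a function of one coordinate keeps it a product. -/
lemma normalId_withDensity_coord {d : ℕ} (μ : EuclideanSpace ℝ (Fin d)) (i : Fin d)
    {f : ℝ → ℝ≥0∞} (hf : Measurable f) (hf₁ : ∀ t, f t ≤ 1) :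
    (normalId d μ).withDensity (fun x ↦ f (x i))
      = (Measure.pi (Function.update (fun j ↦ gaussianReal (μ j) 1) i
          ((gaussianReal (μ i) 1).withDensity f))).map (WithLp.toLp 2) := by
  have hl : Measurable (WithLp.toLp 2 : (Fin d → ℝ) → EuclideanSpace ℝ (Fin d)) := by fun_prop
  let g : Fin d → ℝ → ℝ≥0∞ := fun j ↦ if j = i then f else 1
  have hg : ∀ j, Measurable (g j) := by
    intro j
    by_cases h : j = i
    · simpa [g, h] using hf
    · simpa [g, h] using measurable_one
  have hg₁ : ∀ j t, g j t ≤ 1 := by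
    intro j t
    by_cases h : j = i
    · simpa [g, h] using hf₁ t
    · simp [g, h]
  have hfin : ∀ j, IsFiniteMeasure ((gaussianReal (μ j) 1).withDensity (g j)) := fun j ↦
    isFiniteMeasure_withDensity
      (ne_top_of_le_ne_top ENNReal.one_ne_top ((lintegral_mono (hg₁ j)).trans (by simp)))
  have hupd : Function.update (fun j ↦ gaussianReal (μ j) 1) i
      ((gaussianReal (μ i) 1).withDensity f)
        = fun j ↦ (gaussianReal (μ j) 1).withDensity (g j) := by
    ext1 j
    by_cases h : j = i
    · subst h; simp [g]
    · simp [g, h, withDensity_one]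
  have hprod : (fun x : Fin d → ℝ ↦ ∏ j, g j (x j)) = fun x ↦ f (x i) := by
    ext x
    rw [Finset.prod_eq_single i]
    · simp [g]
    · intro j _ h; simp [g, h]
    · simp
  rw [hupd, pi_withDensity hg, hprod, normalId_eq_map_pi]
  ext S hS
  rw [withDensity_apply _ hS, setLIntegral_map (f := fun x : EuclideanSpace ℝ (Fin d) ↦ f (x i)) hS
      (hf.comp (by fun_prop)) hl, Measure.map_apply hl hS, withDensity_apply _ (hl hS)]

variable {n : ℕ}

/-- The mean `s e₁`, along the coordinate on which the width of the band depends. -/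
noncomputable def shiftedMean (n : ℕ) (s : ℝ) : EuclideanSpace ℝ (Fin (n + 3)) :=
  EuclideanSpace.single 1 s

lemma shiftedMean_one (s : ℝ) : shiftedMean n s 1 = s := by simp [shiftedMean]

lemma shiftedMean_of_ne (s : ℝ) {i : Fin (n + 3)} (h : i ≠ 1) : shiftedMean n s i = 0 := by
  simp [shiftedMean, h]

lemma disjoint_ball_shiftedMean (n : ℕ) :
    Disjoint {x : EuclideanSpace ℝ (Fin (n + 3)) | ‖x - shiftedMean n 2‖ ≤ 1}
      {x | ‖x - shiftedMean n (-2)‖ ≤ 1} := by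
  refine Set.disjoint_left.2 fun x h₁ h₂ ↦ ?_
  have e₁ := (PiLp.norm_apply_le (x - shiftedMean n 2) 1).trans h₁
  have e₂ := (PiLp.norm_apply_le (x - shiftedMean n (-2)) 1).trans h₂
  rw [PiLp.sub_apply, shiftedMean_one, Real.norm_eq_abs, abs_le] at e₁ e₂
  linarith [e₁.1, e₂.2]

/-- The mass that `N(2 e₁, I)` gives to the sets assembled from the band. It depends neither on the
dimension nor on the set. -/
noncomputable def bandMass : ℝ≥0∞ :=
  ∫⁻ t, ENNReal.ofReal (Real.sigmoid (-4 * t)) ∂gaussianReal 2 1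

lemma bandMass_le_one : bandMass ≤ 1 := by
  refine (lintegral_mono (g := fun _ ↦ 1) fun t ↦ ?_).trans (by simp)
  exact ENNReal.ofReal_le_one.2 (Real.sigmoid_le_one _)

lemma bandMass_ne_top : bandMass ≠ ∞ := ne_top_of_le_ne_top ENNReal.one_ne_top bandMass_le_one

lemma measurable_sigmoid_mul : Measurable fun t : ℝ ↦ Real.sigmoid (-4 * t) :=
  continuous_sigmoid.measurable.comp (measurable_const_mul (-4 : ℝ))

lemma bandMass_ne_zero : bandMass ≠ 0 := by
  rw [bandMass, Ne, lintegral_eq_zero_iff measurable_sigmoid_mul.ennreal_ofReal]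
  intro h
  obtain ⟨t, ht⟩ := h.exists
  have := Real.sigmoid_pos (-4 * t)
  simp only [Pi.zero_apply, ENNReal.ofReal_eq_zero] at ht
  linarith

lemma lintegral_one_sub_sigmoid :
    ∫⁻ t, ENNReal.ofReal (1 - Real.sigmoid (-4 * t)) ∂gaussianReal (-2) 1 = bandMass := by
  have := congrArg (fun ρ : Measure ℝ ↦ ρ Set.univ) gaussianReal_withDensity_sigmoid
  simpa [withDensity_apply, bandMass] using this.symm

lemma volume_Ici_inter_Ico {q : ℝ} (hq₀ : 0 ≤ q) :
    volume (Set.Ici q ∩ Set.Ico (0 : ℝ) 1) = ENNReal.ofReal (1 - q) := by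
  have : Set.Ici q ∩ Set.Ico (0 : ℝ) 1 = Set.Ico q 1 := by
    ext s
    simp only [Set.mem_inter_iff, Set.mem_Ici, Set.mem_Ico]
    constructor
    · rintro ⟨h, -, h'⟩; exact ⟨h, h'⟩
    · rintro ⟨h, h'⟩; exact ⟨h, hq₀.trans h, h'⟩
  rw [this, Real.volume_Ico]

/-- Whatever the coordinate `x 1` and the rotation are, the coordinate `x 0` is conditionally
uniform on the circle, so the mass of the rotated bands does not depend on the rotations. -/
lemma normalId_cellwiseSet {K : Set (EuclideanSpace ℝ (Fin (n + 3)) × ℝ)} (hK : MeasurableSet K)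
    {J : ℝ → Set ℝ} (hJ : ∀ s, MeasurableSet (J s))
    (hKJ : ∀ x t, (x, t) ∈ K ↔ Int.fract (gaussianCDF (x 0) + t) ∈ J (x 1))
    {f : ℝ → ℝ≥0∞} (hf : Measurable f) (hJf : ∀ s, volume (J s ∩ Set.Ico 0 1) = f s)
    (s : ℝ) (θ : (Fin n → Bool) → ℝ) :
    normalId (n + 3) (shiftedMean n s) (cellwiseSet signCell K θ)
      = ∫⁻ t, f t ∂gaussianReal s 1 := by
  rw [normalId_eq_lintegral_replaceCoord _ 0 (measurableSet_cellwiseSet measurable_signCell hK θ)]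
  have h10 : (1 : Fin (n + 3)) ≠ 0 := one_ne_zero
  have h : ∀ x : EuclideanSpace ℝ (Fin (n + 3)), gaussianReal (shiftedMean n s 0) 1
      {t | replaceCoord x 0 t ∈ cellwiseSet signCell K θ} = f (x 1) := by
    intro x
    rw [shiftedMean_of_ne s h10.symm, ← hJf,
      ← gaussianReal_fract_gaussianCDF_add_mem (θ (signCell x)) (hJ (x 1))]
    congr 1
    ext t
    change (_, _) ∈ K ↔ _
    rw [hKJ, signCell_replaceCoord_zero, replaceCoord_self, replaceCoord_of_ne x h10]
    rfl
  simp_rw [h]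
  have hm : Measurable fun x : EuclideanSpace ℝ (Fin (n + 3)) ↦ x 1 := by fun_prop
  rw [← lintegral_map hf hm, normalId_map_coord, shiftedMean_one]

lemma mem_band_iff (x : EuclideanSpace ℝ (Fin (n + 3))) (t : ℝ) : (x, t) ∈ band n ↔
    Int.fract (gaussianCDF (x 0) + t) ∈ Set.Iio (Real.sigmoid (-4 * x 1)) := Iff.rfl

lemma mem_compl_band_iff (x : EuclideanSpace ℝ (Fin (n + 3))) (t : ℝ) : (x, t) ∈ (band n)ᶜ ↔
    Int.fract (gaussianCDF (x 0) + t) ∈ Set.Ici (Real.sigmoid (-4 * x 1)) := by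
  rw [Set.mem_compl_iff, mem_band_iff, Set.mem_Iio, not_lt, Set.mem_Ici]

lemma normalId_cellwiseSet_band (θ : (Fin n → Bool) → ℝ) :
    normalId (n + 3) (shiftedMean n 2) (cellwiseSet signCell (band n) θ) = bandMass :=
  normalId_cellwiseSet (J := fun s ↦ Set.Iio (Real.sigmoid (-4 * s))) (measurableSet_band n)
    (fun _ ↦ measurableSet_Iio) mem_band_iff measurable_sigmoid_mul.ennreal_ofReal
    (fun _ ↦ volume_Iio_inter_Ico (Real.sigmoid_le_one _)) 2 θ

lemma normalId_cellwiseSet_compl_band (θ : (Fin n → Bool) → ℝ) :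
    normalId (n + 3) (shiftedMean n (-2)) (cellwiseSet signCell (band n)ᶜ θ) = bandMass :=
  (normalId_cellwiseSet (J := fun s ↦ Set.Ici (Real.sigmoid (-4 * s))) (measurableSet_band n).compl
    (fun _ ↦ measurableSet_Ici) mem_compl_band_iff
    (measurable_sigmoid_mul.const_sub 1).ennreal_ofReal
    (fun _ ↦ volume_Ici_inter_Ico (Real.sigmoid_nonneg _)) (-2) θ).trans lintegral_one_sub_sigmoid

lemma coverage_band (x : EuclideanSpace ℝ (Fin (n + 3))) :
    volume.restrict (Set.Ioc (0 : ℝ) 1) {t | (x, t) ∈ band n}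
      = ENNReal.ofReal (Real.sigmoid (-4 * x 1)) := by
  simp_rw [mem_band_iff, add_comm (gaussianCDF (x 0))]
  rw [volume_fract_add_mem _ measurableSet_Iio, volume_Iio_inter_Ico (Real.sigmoid_le_one _)]

lemma coverage_compl_band (x : EuclideanSpace ℝ (Fin (n + 3))) :
    volume.restrict (Set.Ioc (0 : ℝ) 1) {t | (x, t) ∈ (band n)ᶜ}
      = ENNReal.ofReal (1 - Real.sigmoid (-4 * x 1)) := by
  simp_rw [mem_compl_band_iff, add_comm (gaussianCDF (x 0))]
  rw [volume_fract_add_mem _ measurableSet_Ici, volume_Ici_inter_Ico (Real.sigmoid_nonneg _)]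

lemma normalId_withDensity_coverage_eq (n : ℕ) :
    (normalId (n + 3) (shiftedMean n 2)).withDensity
        (fun x ↦ ENNReal.ofReal (Real.sigmoid (-4 * x 1)))
      = (normalId (n + 3) (shiftedMean n (-2))).withDensity
        (fun x ↦ ENNReal.ofReal (1 - Real.sigmoid (-4 * x 1))) := by
  rw [normalId_withDensity_coord (f := fun t ↦ ENNReal.ofReal (Real.sigmoid (-4 * t))) _ 1
      measurable_sigmoid_mul.ennreal_ofReal
      (fun _ ↦ ENNReal.ofReal_le_one.2 (Real.sigmoid_le_one _)),
    normalId_withDensity_coord (f := fun t ↦ ENNReal.ofReal (1 - Real.sigmoid (-4 * t))) _ 1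
      (measurable_sigmoid_mul.const_sub 1).ennreal_ofReal
      (fun t ↦ ENNReal.ofReal_le_one.2 (by linarith [Real.sigmoid_nonneg (-4 * t)])),
    shiftedMean_one, shiftedMean_one, gaussianReal_withDensity_sigmoid]
  congr 2
  ext1 j
  by_cases h : j = 1
  · subst h; simp
  · simp [h, shiftedMean_of_ne]

lemma normalId_withDensity_coverage_signCell (j : Fin n → Bool) :
    (normalId (n + 3) (shiftedMean n 2)).withDensity
        (fun x ↦ ENNReal.ofReal (Real.sigmoid (-4 * x 1))) (signCell ⁻¹' {j})
      = bandMass * (Fintype.card (Fin n → Bool) : ℝ≥0∞)⁻¹ := by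
  have hf₁ : ∀ t, ENNReal.ofReal (Real.sigmoid (-4 * t)) ≤ 1 :=
    fun _ ↦ ENNReal.ofReal_le_one.2 (Real.sigmoid_le_one _)
  rw [normalId_withDensity_coord (f := fun t ↦ ENNReal.ofReal (Real.sigmoid (-4 * t))) _ 1
      measurable_sigmoid_mul.ennreal_ofReal hf₁,
    Measure.map_apply (by fun_prop) (measurable_signCell (measurableSet_singleton j))]
  have hfin : IsFiniteMeasure ((gaussianReal (shiftedMean n 2 1) 1).withDensity
      fun t ↦ ENNReal.ofReal (Real.sigmoid (-4 * t))) :=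
    isFiniteMeasure_withDensity
      (ne_top_of_le_ne_top ENNReal.one_ne_top ((lintegral_mono hf₁).trans (by simp)))
  have hσ : ∀ k, SigmaFinite (Function.update (fun k ↦ gaussianReal (shiftedMean n 2 k) 1) 1
      ((gaussianReal (shiftedMean n 2 1) 1).withDensity
        fun t ↦ ENNReal.ofReal (Real.sigmoid (-4 * t))) k) := by
    intro k
    by_cases h : k = 1
    · subst h; rw [Function.update_self]; infer_instance
    · rw [Function.update_of_ne h]; infer_instance
  let s : Fin (n + 3) → Set ℝ := Fin.cons Set.univ (Fin.cons Set.univ (Fin.cons Set.univ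
    fun i : Fin n ↦ {t | decide (0 < t) = j i}))
  have hset : (WithLp.toLp 2 : (Fin (n + 3) → ℝ) → EuclideanSpace ℝ (Fin (n + 3))) ⁻¹'
      (signCell ⁻¹' {j}) = Set.univ.pi s := by
    ext x
    simp only [Set.mem_preimage, Set.mem_singleton_iff, Set.mem_univ_pi, Fin.forall_fin_succ, s,
      Fin.cons_zero, Fin.cons_succ, Set.mem_univ, true_and, Set.mem_ofPred_eq]
    exact funext_iff
  have h1 : (Fin.succ 0 : Fin (n + 3)) = 1 := rfl
  have h3 : ∀ i : Fin n, i.succ.succ.succ ≠ (1 : Fin (n + 3)) := fun i h ↦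
    Fin.succ_ne_zero _ (Fin.succ_injective _ (h.trans h1.symm))
  have h2 : (Fin.succ (Fin.succ 0) : Fin (n + 3)) ≠ 1 := fun h ↦
    Fin.succ_ne_zero _ (Fin.succ_injective _ (h.trans h1.symm))
  rw [hset, Measure.pi_pi, Fin.prod_univ_succ, Fin.prod_univ_succ, Fin.prod_univ_succ]
  simp only [s, Fin.cons_zero, Fin.cons_succ]
  rw [h1, Function.update_self, Function.update_of_ne (zero_ne_one), Function.update_of_ne h2,
    measure_univ (μ := gaussianReal (shiftedMean n 2 0) 1),
    measure_univ (μ := gaussianReal (shiftedMean n 2 (Fin.succ (Fin.succ 0))) 1), one_mul, one_mul,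
    shiftedMean_one]
  have hcell : ∀ i : Fin n, Function.update (fun k ↦ gaussianReal (shiftedMean n 2 k) 1) 1
      ((gaussianReal 2 1).withDensity
        fun t ↦ ENNReal.ofReal (Real.sigmoid (-4 * t))) i.succ.succ.succ
        {t | decide (0 < t) = j i} = 2⁻¹ := by
    intro i
    rw [Function.update_of_ne (h3 i), shiftedMean_of_ne _ (h3 i), gaussianReal_setOf_decide_pos]
  simp_rw [hcell]
  rw [withDensity_apply _ MeasurableSet.univ, Measure.restrict_univ, Finset.prod_const,
    Finset.card_univ, Fintype.card_fin, Fintype.card_pi_const, Fintype.card_bool, ← ENNReal.inv_pow]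
  simp [bandMass]

lemma truncatedNormalId_eq_restrict {d : ℕ} {μ : EuclideanSpace ℝ (Fin d)}
    {S : Set (EuclideanSpace ℝ (Fin d))} {M : ℝ≥0∞} (h : normalId d μ S = M) :
    truncatedNormalId d μ S = (M⁻¹ • normalId d μ).restrict S := by
  rw [truncatedNormalId, ProbabilityTheory.cond, h, Measure.restrict_smul]

/-- The sample complexity of estimating the mean over a family that contains `bandFamily n`. -/
theorem two_mul_sub_one_le_of_estimatesMean {𝒮 : Set (Set (EuclideanSpace ℝ (Fin (n + 3))))}
    (h𝒮 : bandFamily n ⊆ 𝒮) {p : ℝ} (hp : 0 ≤ p) {m : ℕ}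
    (A : Kernel (Fin m → EuclideanSpace ℝ (Fin (n + 3))) (EuclideanSpace ℝ (Fin (n + 3))))
    [IsMarkovKernel A] (hA : EstimatesMean (n + 3) 𝒮 bandMass.toReal p m A) :
    2 * p - 1 ≤ (m : ℝ) ^ 2 / 2 ^ n := by
  have hMinv : bandMass⁻¹ ≠ ∞ := ENNReal.inv_ne_top.2 bandMass_ne_zero
  have hMM : bandMass⁻¹ * bandMass = 1 := ENNReal.inv_mul_cancel bandMass_ne_zero bandMass_ne_top
  -- as all the masses equal `bandMass`, conditioning is restriction of these multiples
  let N : ℝ → Measure (EuclideanSpace ℝ (Fin (n + 3))) :=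
    fun s ↦ bandMass⁻¹ • normalId (n + 3) (shiftedMean n s)
  have hNfin : ∀ s, IsFiniteMeasure (N s) := fun s ↦ Measure.smul_finite _ hMinv
  let τ : Measure ℝ := volume.restrict (Set.Ioc (0 : ℝ) 1)
  have hτ : IsProbabilityMeasure τ := ⟨by simp [τ]⟩
  let ν : Measure (EuclideanSpace ℝ (Fin (n + 3))) :=
    bandMass⁻¹ • (normalId (n + 3) (shiftedMean n 2)).withDensity
      (fun x ↦ ENNReal.ofReal (Real.sigmoid (-4 * x 1)))
  have hν : ∀ j, ν (signCell ⁻¹' {j}) = (Fintype.card (Fin n → Bool) : ℝ≥0∞)⁻¹ := by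
    intro j
    rw [Measure.smul_apply, normalId_withDensity_coverage_signCell, smul_eq_mul, ← mul_assoc, hMM,
      one_mul]
  have hνprob : IsProbabilityMeasure ν := by
    refine ⟨?_⟩
    have hm : Measurable fun x : EuclideanSpace ℝ (Fin (n + 3)) ↦ x 1 := by fun_prop
    rw [Measure.smul_apply, withDensity_apply _ MeasurableSet.univ, Measure.restrict_univ,
      ← lintegral_map (f := fun t ↦ ENNReal.ofReal (Real.sigmoid (-4 * t)))
        measurable_sigmoid_mul.ennreal_ofReal hm, normalId_map_coord, shiftedMean_one]
    exact hMM
  have hprob : ∀ (s : ℝ) (S : Set (EuclideanSpace ℝ (Fin (n + 3)))),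
      normalId (n + 3) (shiftedMean n s) S = bandMass → IsProbabilityMeasure ((N s).restrict S) :=
    fun s S h ↦ ⟨by rw [Measure.restrict_apply_univ, Measure.smul_apply, h, smul_eq_mul, hMM]⟩
  have hest : ∀ (s : ℝ) (S : Set (EuclideanSpace ℝ (Fin (n + 3)))), S ∈ 𝒮 →
      normalId (n + 3) (shiftedMean n s) S = bandMass → ENNReal.ofReal p ≤
        ((Measure.pi fun _ : Fin m ↦ (N s).restrict S).bind A) {x | ‖x - shiftedMean n s‖ ≤ 1} := by
    intro s S hS h
    have := hA S hS (shiftedMean n s) (by rw [measureReal_def, h])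
    rw [truncatedNormalId_eq_restrict h] at this
    exact ENNReal.ofReal_le_of_le_toReal this
  have hB : ∀ s, MeasurableSet {x : EuclideanSpace ℝ (Fin (n + 3)) | ‖x - shiftedMean n s‖ ≤ 1} :=
    fun s ↦ measurableSet_le (by fun_prop) measurable_const
  have key := two_mul_le_of_estimator measurable_signCell τ (measurableSet_band n)
    (measurableSet_band n).compl (N 2) (N (-2))
    (fun θ ↦ hprob 2 _ (normalId_cellwiseSet_band θ))
    (fun θ ↦ hprob (-2) _ (normalId_cellwiseSet_compl_band θ)) (ν := ν)
    (by simp_rw [τ, coverage_band]; exact withDensity_smul_measure _ _)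
    (by
      simp_rw [τ, coverage_compl_band]
      exact (withDensity_smul_measure _ _).trans (by rw [← normalId_withDensity_coverage_eq]))
    hν A (hB 2) (hB (-2)) (disjoint_ball_shiftedMean n) (p := ENNReal.ofReal p)
    (fun θ ↦ hest 2 _ (h𝒮 (Or.inl ⟨θ, rfl⟩)) (normalId_cellwiseSet_band θ))
    (fun θ ↦ hest (-2) _ (h𝒮 (Or.inr ⟨θ, rfl⟩)) (normalId_cellwiseSet_compl_band θ))
  have hr : (1 : ℝ≥0∞) + (m : ℝ≥0∞) ^ 2 * (Fintype.card (Fin n → Bool) : ℝ≥0∞)⁻¹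
      = ENNReal.ofReal (1 + (m : ℝ) ^ 2 / 2 ^ n) := by
    rw [ENNReal.ofReal_add zero_le_one (by positivity), ENNReal.ofReal_one,
      ENNReal.ofReal_div_of_pos (by positivity), ENNReal.ofReal_pow (by positivity),
      ENNReal.ofReal_pow (by positivity), ENNReal.ofReal_natCast, Fintype.card_pi_const,
      Fintype.card_bool, div_eq_mul_inv]
    simp
  rw [hr, ← ENNReal.ofReal_add hp hp, ENNReal.ofReal_le_ofReal_iff (by positivity)] at key
  linarith

end TwoHypotheses

/-! ### The hard families -/

section Assembly

/-- Without samples no estimator works if the family contains the whole space: all means are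
admissible, and the output does not depend on the mean. -/
lemma pos_of_estimatesMean_univ {d : ℕ} (hd : 1 ≤ d) {𝒮 : Set (Set (EuclideanSpace ℝ (Fin d)))}
    (h𝒮 : Set.univ ∈ 𝒮) {α p : ℝ} (hα : α ≤ 1) (hp : 1 / 2 < p) {m : ℕ}
    (A : Kernel (Fin m → EuclideanSpace ℝ (Fin d)) (EuclideanSpace ℝ (Fin d)))
    [IsMarkovKernel A] (hA : EstimatesMean d 𝒮 α p m A) : 1 ≤ m ∧ p ≤ 1 := by
  have hmass : ∀ μ, α ≤ (normalId d μ).real Set.univ := fun μ ↦ by simpa using hα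
  have hprob : ∀ μ, IsProbabilityMeasure (truncatedNormalId d μ Set.univ) := fun μ ↦
    cond_isProbabilityMeasure (by simp)
  have h := fun μ ↦ hA Set.univ h𝒮 μ (hmass μ)
  have hP : ∀ μ, IsProbabilityMeasure
      ((Measure.pi fun _ : Fin m => truncatedNormalId d μ Set.univ).bind A) := fun μ ↦ inferInstance
  refine ⟨Nat.one_le_iff_ne_zero.2 ?_, (h 0).trans measureReal_le_one⟩
  rintro rfl
  let i₀ : Fin d := ⟨0, hd⟩
  let e : EuclideanSpace ℝ (Fin d) := EuclideanSpace.single i₀ 3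
  have h₀ := h 0
  have h₁ := h e
  have heq : (Measure.pi fun _ : Fin 0 => truncatedNormalId d e Set.univ)
      = Measure.pi fun _ : Fin 0 => truncatedNormalId d 0 Set.univ := by
    congr 1
    exact funext fun i ↦ i.elim0
  rw [heq] at h₁
  have hdisj : Disjoint {x : EuclideanSpace ℝ (Fin d) | ‖x - 0‖ ≤ 1} {x | ‖x - e‖ ≤ 1} := by
    refine Set.disjoint_left.2 fun x h₁ h₂ ↦ ?_
    have e₁ := (PiLp.norm_apply_le (x - 0) i₀).trans h₁
    have e₂ := (PiLp.norm_apply_le (x - e) i₀).trans h₂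
    rw [PiLp.sub_apply, Real.norm_eq_abs, abs_le] at e₁ e₂
    simp only [e, PiLp.zero_apply, PiLp.single_apply, if_true] at e₁ e₂
    linarith [e₁.2, e₂.1]
  have hm : MeasurableSet {x : EuclideanSpace ℝ (Fin d) | ‖x - e‖ ≤ 1} :=
    measurableSet_le (by fun_prop) measurable_const
  have h₂ := measureReal_union (μ := (Measure.pi fun _ : Fin 0 =>
    truncatedNormalId d 0 Set.univ).bind A) hdisj hm
  have h₃ : ((Measure.pi fun _ : Fin 0 => truncatedNormalId d 0 Set.univ).bind A).real
    ({x : EuclideanSpace ℝ (Fin d) | ‖x - 0‖ ≤ 1} ∪ {x | ‖x - e‖ ≤ 1}) ≤ 1 := measureReal_le_one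
  linarith

/-- Adding unions of orthants makes the VC dimension of a family exactly `2 ^ d`. -/
lemma exists_superfamily {d : ℕ} {ℬ : Set (Set (EuclideanSpace ℝ (Fin d)))}
    (hmeas : ∀ S ∈ ℬ, MeasurableSet S)
    (hsurf : ∀ S ∈ ℬ, gaussianSurfaceArea d S ≤ ENNReal.ofReal (16 * d))
    (hVC : familyVCDim ℬ ≤ (2 ^ d : ℕ)) :
    ∃ 𝒮, ℬ ⊆ 𝒮 ∧ (∀ S ∈ 𝒮, MeasurableSet S) ∧
      familyGaussianSurfaceArea d 𝒮 ≤ ENNReal.ofReal (16 * d) ∧ familyVCDim 𝒮 = 2 ^ d := by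
  have hge : ((2 ^ d : ℕ) : ℕ∞) ≤ familyVCDim (ℬ ∪ orthantUnions d) := by
    refine (le_familyVCDim_orthantUnions d).trans (iSup_mono fun X ↦ iSup_mono' fun hX ↦ ?_)
    exact ⟨hX.mono Set.subset_union_right, le_rfl⟩
  obtain ⟨ℱ, hℱ, e⟩ := exists_familyVCDim_union_eq (Set.finite_range _) hVC hge
  refine ⟨ℬ ∪ ℱ, Set.subset_union_left, ?_, iSup₂_le ?_, by rw [e]; norm_cast⟩
  · rintro S (hS | hS)
    · exact hmeas S hS
    · exact measurableSet_of_mem_orthantUnions (hℱ hS)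
  · rintro S (hS | hS)
    · exact hsurf S hS
    · refine (gaussianSurfaceArea_le_of_mem_orthantUnions (hℱ hS)).trans ?_
      exact ENNReal.ofReal_le_ofReal (by linarith [Nat.cast_nonneg (α := ℝ) d])

/-- The hard family in dimension `d`. The bands need three coordinates; in dimensions one and two
the bound only says that some sample is needed, for which the whole space suffices. -/
lemma exists_hardFamily {d : ℕ} (hd : 1 ≤ d) :
    ∃ 𝒮 : Set (Set (EuclideanSpace ℝ (Fin d))), (∀ S ∈ 𝒮, MeasurableSet S) ∧
      familyGaussianSurfaceArea d 𝒮 ≤ ENNReal.ofReal (16 * d) ∧ familyVCDim 𝒮 = 2 ^ d ∧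
      ∀ p : ℝ, 1 / 2 < p → ∀ (m : ℕ)
        (A : Kernel (Fin m → EuclideanSpace ℝ (Fin d)) (EuclideanSpace ℝ (Fin d))),
        IsMarkovKernel A → EstimatesMean d 𝒮 bandMass.toReal p m A →
          (2 * p - 1) / 8 * 2 ^ d ≤ (m : ℝ) ^ 2 := by
  rcases lt_or_ge d 3 with hd3 | hd3
  -- here `(2 * p - 1) / 8 * 2 ^ d ≤ 1 / 2`, because `p ≤ 1` and `d ≤ 2`
  · have hVC : familyVCDim ({Set.univ} : Set (Set (EuclideanSpace ℝ (Fin d)))) ≤ (2 ^ d : ℕ) := by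
      rw [familyVCDim_le_iff]
      intro X hX
      obtain ⟨S, rfl, e⟩ := hX ∅ (Finset.empty_subset X)
      rw [Set.inter_univ, Finset.coe_inj] at e
      simp [e]
    obtain ⟨𝒮, hsub, hmeas, hsurf, hdim⟩ := exists_superfamily (d := d) (ℬ := {Set.univ})
      (by simp) (by simp [gaussianSurfaceArea]) hVC
    refine ⟨𝒮, hmeas, hsurf, hdim, fun p hp m A _ hA ↦ ?_⟩
    obtain ⟨hm, hp1⟩ := pos_of_estimatesMean_univ hd (hsub rfl)
      (ENNReal.toReal_le_of_le_ofReal zero_le_one (by simpa using bandMass_le_one)) hp A hA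
    have hm' : (1 : ℝ) ≤ (m : ℝ) ^ 2 := one_le_pow₀ (by exact_mod_cast hm)
    have h4 : (2 : ℝ) ^ d ≤ 2 ^ 2 := pow_le_pow_right₀ one_le_two (by omega)
    have h0 : (0 : ℝ) < 2 ^ d := by positivity
    nlinarith
  · obtain ⟨n, rfl⟩ : ∃ n, d = n + 3 := ⟨d - 3, by omega⟩
    obtain ⟨𝒮, hsub, hmeas, hsurf, hdim⟩ := exists_superfamily (ℬ := bandFamily n)
      (fun S hS ↦ measurableSet_of_mem_bandFamily hS)
      (fun S hS ↦ gaussianSurfaceArea_le_of_mem_bandFamily hS) (familyVCDim_bandFamily_le n)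
    refine ⟨𝒮, hmeas, hsurf, hdim, fun p hp m A _ hA ↦ ?_⟩
    have h := two_mul_sub_one_le_of_estimatesMean hsub (by linarith) A hA
    rw [le_div_iff₀ (by positivity)] at h
    rw [pow_add]
    linarith

end Assembly

theorem theorem6p1 :
    ∃ 𝒮 : ∀ d : ℕ, Set (Set (EuclideanSpace ℝ (Fin d))),
      (∀ d : ℕ, 1 ≤ d → ∀ S ∈ 𝒮 d, MeasurableSet S) ∧
      (∃ C : ℝ, 0 < C ∧ ∀ d : ℕ, 1 ≤ d →
        familyGaussianSurfaceArea d (𝒮 d) ≤ ENNReal.ofReal (C * d)) ∧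
      (∀ d : ℕ, 1 ≤ d → familyVCDim (𝒮 d) = 2 ^ d) ∧
      (∃ α : ℝ, 0 < α ∧ ∀ p : ℝ, 1 / 2 < p → ∃ c : ℝ, 0 < c ∧
        ∀ d : ℕ, 1 ≤ d → ∀ (m : ℕ)
          (A : Kernel (Fin m → EuclideanSpace ℝ (Fin d)) (EuclideanSpace ℝ (Fin d))),
          IsMarkovKernel A → EstimatesMean d (𝒮 d) α p m A →
            c * (2 : ℝ) ^ ((d : ℝ) / 2) ≤ (m : ℝ)) := by
  have hex : ∀ d : ℕ, ∃ 𝒮 : Set (Set (EuclideanSpace ℝ (Fin d))), 1 ≤ d →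
      (∀ S ∈ 𝒮, MeasurableSet S) ∧
      familyGaussianSurfaceArea d 𝒮 ≤ ENNReal.ofReal (16 * d) ∧ familyVCDim 𝒮 = 2 ^ d ∧
      ∀ p : ℝ, 1 / 2 < p → ∀ (m : ℕ)
        (A : Kernel (Fin m → EuclideanSpace ℝ (Fin d)) (EuclideanSpace ℝ (Fin d))),
        IsMarkovKernel A → EstimatesMean d 𝒮 bandMass.toReal p m A →
          (2 * p - 1) / 8 * 2 ^ d ≤ (m : ℝ) ^ 2 := by
    intro d
    by_cases hd : 1 ≤ d
    · obtain ⟨𝒮, h⟩ := exists_hardFamily hd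
      exact ⟨𝒮, fun _ ↦ h⟩
    · exact ⟨∅, fun h ↦ absurd h hd⟩
  choose 𝒮 h𝒮 using hex
  refine ⟨𝒮, fun d hd ↦ (h𝒮 d hd).1, ⟨16, by norm_num, fun d hd ↦ (h𝒮 d hd).2.1⟩,
    fun d hd ↦ (h𝒮 d hd).2.2.1, bandMass.toReal,
    ENNReal.toReal_pos bandMass_ne_zero bandMass_ne_top, fun p hp ↦
    ⟨√((2 * p - 1) / 8), Real.sqrt_pos.2 (by linarith), fun d hd m A hA hest ↦ ?_⟩⟩
  refine (pow_le_pow_iff_left₀ (by positivity) (Nat.cast_nonneg m) two_ne_zero).1 ?_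
  have h := (h𝒮 d hd).2.2.2 p hp m A hA hest
  have h2 : ((2 : ℝ) ^ ((d : ℝ) / 2)) ^ 2 = 2 ^ d := by
    rw [← Real.rpow_mul_natCast zero_le_two]
    simp
  rwa [mul_pow, Real.sq_sqrt (by linarith), h2]
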